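/- Let $d\ge 1$ and let $\mathbf k=(k_1,\dots,k_{d+1})$ be a sequence of integers with $k_i\ge 1$ for all $i$. Let $V=\{x\in\mathbb R^{d+1}: x_1+\dots+x_{d+1}=0\}$. The hyperplanes $\{x\in V: x_j-x_i=m\}$ ($1\le i<j\le d+1$, $m\in\mathbb Z$) of the affine Coxeter arrangement of type $\widetilde A_d$ cut $V$ into relatively open cells; the faces of the affine Coxeter complex $\widetilde{\mathcal C}_d$ are the closures of these cells, and its vertices are the points that are faces. Put $\widetilde w_i=e_i-\frac1{d+1}\sum_{j=1}^{d+1}e_j\in V$, let $M_{\mathbf k}$ be the $(d+1)\times(d+1)$ integer matrix whose $i$-th row has entry $k_i+1$ in column $i$, entry $-k_{i+1}$ in column $i+1$ (indices cyclic modulo $d+1$), and $0$ elsewhere, and let $$\widetilde\Lambda_{\mathbf k}=\Big\{\sum_{i} a_i\widetilde w_i : (a_1,\dots,a_{d+1})=(b_1,\dots,b_{d+1})M_{\mathbf k},\ b_i\in\mathbb Z\Big\}\subset V .$$ Let $T_{\mathbf k}=\widetilde{\mathcal C}_d/\widetilde\Lambda_{\mathbf k}$ be the set of classes of faces of $\widetilde{\mathcal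 C}_d$ up to translation by vectors of $\widetilde\Lambda_{\mathbf k}$, where a class is contained in another if some representative of the first is contained in some representative of the second. Then: 1. $T_{\mathbf k}$ is a (genuine) simplicial complex: no two distinct vertices of one face of $\widetilde{\mathcal C}_d$ are identified, and mapping a class of faces to the set of vertex classes contained in it is an isomorphism of ordered sets from $T_{\mathbf k}$ onto the set of non-empty faces, ordered by inclusion, of an abstract simplicial complex $K$ on the set of vertices of $T_{\mathbf k}$. 2. $T_{\mathbf k}$ triangulates the $d$-dimensional torus: there is a homeomorphism from the geometric realization $|K|$ to $V/\widetilde\Lambda_{\mathbf k}$ that maps, for every face $F$ of $\widetilde{\mathcal C}_d$, the closed simplex of the class of $F$ onto the image of $F$, and $|K|$ is homeomorphic to the torus $(\mathbb R/\mathbb Z)^d$. 3. $T_{\mathbf k}$ has exactly $D_{\mathbf k}=\det M_{\mathbf k}$ vertices. -/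

import Mathlib

open scoped Pointwise

/-! ### Geometric realization of an abstract simplicial complex -/

/-- The closed geometric simplex with vertex set `s`: families of barycentric coordinates that are
non-negative, vanish outside `s` and sum to one. -/
def closedSimplex {ι : Type*} (s : Finset ι) : Set (ι → ℝ) :=
  {t | (∀ v, 0 ≤ t v) ∧ (∀ v, v ∉ s → t v = 0) ∧ ∑ v ∈ s, t v = 1}

/-- The points of the geometric realization `|K|` of an abstract simplicial complex: the union of
the closed simplices spanned by the faces of `K`. -/
@[ext]
structure Realization {ι : Type*} (K : AbstractSimplicialComplex ι) where
  coord : ι → ℝ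
  mem_simplex : ∃ s ∈ K.faces, coord ∈ closedSimplex s

/-- The inclusion of the closed simplex of a face in the realization. -/
def Realization.ofFace {ι : Type*} (K : AbstractSimplicialComplex ι) (s : {s // s ∈ K.faces})
    (t : closedSimplex s.1) : Realization K :=
  ⟨t.1, s.1, s.2, t.2⟩

/-- The coherent (weak) topology: the finest topology for which the inclusions of all closed
simplices are continuous, each simplex having its Euclidean topology. -/
instance Realization.instTopologicalSpace {ι : Type*} (K : AbstractSimplicialComplex ι) :
    TopologicalSpace (Realization K) :=
  ⨆ s : {s // s ∈ K.faces}, TopologicalSpace.coinduced (Realization.ofFace K s) inferInstance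

/-! ### The affine Coxeter complex of type `A` -/

/-- The space `V = {x ∈ ℝ^(d+1) : x_1 + ⋯ + x_(d+1) = 0}`. -/
def sumZero (d : ℕ) : Submodule ℝ (Fin (d + 1) → ℝ) where
  carrier := {x | ∑ i, x i = 0}
  add_mem' := by
    intro x y hx hy
    simp only [Set.mem_ofPred_eq] at hx hy ⊢
    simp [Finset.sum_add_distrib, hx, hy]
  zero_mem' := by simp
  smul_mem' := by
    intro c x hx
    simp only [Set.mem_ofPred_eq] at hx ⊢
    simp [← Finset.mul_sum, hx]

/-- The (relatively open) cell of the affine Coxeter arrangement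
`{x_j - x_i = m}`, `i < j`, `m ∈ ℤ`, that contains `x`: all points of `V` that lie on the same side
of (or both on) each hyperplane of the arrangement. -/
def coxeterCell (d : ℕ) (x : sumZero d) : Set (sumZero d) :=
  {y | ∀ i j : Fin (d + 1), i < j → ∀ m : ℤ,
    SignType.sign (y.1 j - y.1 i - m) = SignType.sign (x.1 j - x.1 i - m)}

/-- The non-empty faces of the affine Coxeter complex: the closures of the cells of the
arrangement. -/
def coxeterFaces (d : ℕ) : Set (Set (sumZero d)) :=
  {F | ∃ x, F = closure (coxeterCell d x)}

/-- The vertices of the affine Coxeter complex: the points that are faces. -/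
def coxeterVertices (d : ℕ) : Set (sumZero d) :=
  {x | {x} ∈ coxeterFaces d}

/-! ### The sublattice and the quotient complex -/

/-- The matrix `M_k`: row `i` has `k_i + 1` on the diagonal and `-k_(i+1)` in the cyclically next
column, all other entries being `0` (addition in `Fin (d + 1)` is cyclic). -/
def heawoodMatrix {d : ℕ} (k : Fin (d + 1) → ℕ) : Matrix (Fin (d + 1)) (Fin (d + 1)) ℤ :=
  Matrix.of fun i j => (if j = i then (k j : ℤ) + 1 else 0) - (if j = i + 1 then (k j : ℤ) else 0)

/-- The vector `w̃_i = e_i - (e_1 + ⋯ + e_(d+1)) / (d+1)`. -/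
noncomputable def weightVector (d : ℕ) (i : Fin (d + 1)) : Fin (d + 1) → ℝ :=
  Pi.single i 1 - fun _ => 1 / ((d : ℝ) + 1)

/-- The lattice `Λ̃_k` of all `a_1 w̃_1 + ⋯ + a_(d+1) w̃_(d+1)` with `a = b M_k` for an integer row
vector `b`. -/
noncomputable def subLattice {d : ℕ} (k : Fin (d + 1) → ℕ) : AddSubgroup (sumZero d) where
  carrier := {x | ∃ b : Fin (d + 1) → ℤ,
    (x : Fin (d + 1) → ℝ) = ∑ i, ((Matrix.vecMul b (heawoodMatrix k) i : ℤ) : ℝ) • weightVector d i}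
  add_mem' := by
    rintro x y ⟨b, hb⟩ ⟨c, hc⟩
    refine ⟨b + c, ?_⟩
    simp [hb, hc, Matrix.add_vecMul, add_smul, Finset.sum_add_distrib]
  zero_mem' := ⟨0, by simp⟩
  neg_mem' := by
    rintro x ⟨b, hb⟩
    refine ⟨-b, ?_⟩
    simp [hb, Matrix.neg_vecMul]

/-- Two faces are equivalent if one is the translate of the other by a vector of `Λ̃_k`. -/
def faceSetoid {d : ℕ} (k : Fin (d + 1) → ℕ) : Setoid (coxeterFaces d) where
  r F G := ∃ v ∈ subLattice k, (G : Set (sumZero d)) = v +ᵥ (F : Set (sumZero d))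
  iseqv :=
    { refl := fun F => ⟨0, (subLattice k).zero_mem, by simp⟩
      symm := by
        rintro F G ⟨v, hv, h⟩
        exact ⟨-v, (subLattice k).neg_mem hv, by rw [h, neg_vadd_vadd]⟩
      trans := by
        rintro F G H ⟨v, hv, h⟩ ⟨w, hw, h'⟩
        exact ⟨w + v, (subLattice k).add_mem hw hv, by rw [h', h, add_vadd]⟩ }

/-- The (non-empty) faces of the quotient complex `T_k`: the classes of faces of the affine Coxeter
complex under translation by `Λ̃_k`. -/
def TorusFace {d : ℕ} (k : Fin (d + 1) → ℕ) : Type :=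
  Quotient (faceSetoid k)

/-- The class of a face of the affine Coxeter complex. -/
def TorusFace.mk {d : ℕ} (k : Fin (d + 1) → ℕ) (F : coxeterFaces d) : TorusFace k :=
  Quotient.mk (faceSetoid k) F

/-- A class is contained in another if some representative of the first is contained in some
representative of the second. -/
instance TorusFace.instLE {d : ℕ} (k : Fin (d + 1) → ℕ) : LE (TorusFace k) where
  le c c' := ∃ F G : coxeterFaces d, TorusFace.mk k F = c ∧ TorusFace.mk k G = c' ∧
    (F : Set (sumZero d)) ⊆ (G : Set (sumZero d))

/-- The vertices of `T_k`: the classes of the vertices of the affine Coxeter complex. -/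
def TorusVertex {d : ℕ} (k : Fin (d + 1) → ℕ) : Type :=
  {c : TorusFace k // ∃ x : coxeterVertices d, c = TorusFace.mk k ⟨{x.1}, x.2⟩}

/-!
The key observation is that the affine Coxeter complex is a flag complex which can be described
through the oscillation `osc x = max_i x_i - min_i x_i`, a norm on `V`. Its vertices are the points
of the lattice of vectors with integral coordinate differences, and finitely many vertices span a
face precisely if they are pairwise adjacent, that is, at distance at most one.

Every point of `V` has unique barycentric coordinates. Existence (`exists_isBary`) follows by
writing the vector of fractional parts as a combination of indicator vectors of a chain of sets.
Uniqueness (`IsBary.unique`) holds because the coordinate of `x` at a vertex `v` of its simplex is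
`1 - osc (x - v)` (`osc_center_sub`), and because the support of the coordinates of `x` consists of
all lattice points at distance less than one from `x` (`IsBary.mem_support_iff`). The closed cell of
`x` consists of the points whose coordinates are supported in the support of those of `x`
(`mem_closure_coxeterCell_iff_support_subset`), so faces correspond to finite sets of vertices.

The arithmetic input is that a non-zero vector of the sublattice has oscillation at least three
(`eq_zero_of_osc_le_two`). Two vertices of a face have distance at most one, so they are not
identified. If all vertices of one face are equivalent to vertices of another, translate the first
face so that the two share a vertex. Any further vertex of the first face is then within distance
two of the equivalent vertex of the second, and hence equal to it. Thus classes of faces are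
determined by, and ordered like, their sets of vertices (`exists_translate_subset`,
`torusFace_le_iff_vertices`).

Barycentric coordinates descend to a bijection from the quotient of `V` to the realization of the
resulting complex. Its inverse is affine on each simplex, hence continuous, and a continuous
bijection from a compact space to a Hausdorff space is a homeomorphism (`realizationHomeo`). The
same principle identifies the quotient with the standard torus: since the rows of `M` sum to the
all-one vector, the differences of the entries of `x M⁻¹` are integral exactly on the sublattice
(`mem_subLattice_iff_rowCoord`).

Finally, the vertices of the quotient are the integer vectors modulo the row space of `M`, so their
number is `|det M|` (`card_torusVertex`), and the determinant is positive
(`det_heawoodMatrix_pos`).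
-/

/-! ### The oscillation of a vector -/

/-- The oscillation `max_i x_i - min_i x_i` of a vector, written as the largest difference of two
coordinates. It is a norm on `V`. -/
noncomputable def osc {d : ℕ} (x : sumZero d) : ℝ :=
  ⨆ p : Fin (d + 1) × Fin (d + 1), (x.1 p.1 - x.1 p.2)

section Oscillation

variable {d : ℕ}

lemma sub_le_osc (x : sumZero d) (i j : Fin (d + 1)) : x.1 i - x.1 j ≤ osc x :=
  le_ciSup (f := fun p : Fin (d + 1) × Fin (d + 1) => x.1 p.1 - x.1 p.2)
    (Set.finite_range _).bddAbove (i, j)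

lemma osc_le_iff {x : sumZero d} {r : ℝ} : osc x ≤ r ↔ ∀ i j, x.1 i - x.1 j ≤ r :=
  ⟨fun h i j => (sub_le_osc x i j).trans h, fun h => ciSup_le fun p => h p.1 p.2⟩

lemma exists_sub_eq_osc (x : sumZero d) : ∃ i j, x.1 i - x.1 j = osc x := by
  obtain ⟨p, hp⟩ := exists_eq_ciSup_of_finite
    (f := fun p : Fin (d + 1) × Fin (d + 1) => x.1 p.1 - x.1 p.2)
  exact ⟨p.1, p.2, hp⟩

lemma osc_lt_iff {x : sumZero d} {r : ℝ} : osc x < r ↔ ∀ i j, x.1 i - x.1 j < r := by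
  refine ⟨fun h i j => (sub_le_osc x i j).trans_lt h, fun h => ?_⟩
  obtain ⟨i, j, hij⟩ := exists_sub_eq_osc x
  exact hij ▸ h i j

lemma osc_add_le (x y : sumZero d) : osc (x + y) ≤ osc x + osc y := by
  rw [osc_le_iff]
  intro i j
  have h1 := sub_le_osc x i j
  have h2 := sub_le_osc y i j
  simp only [Submodule.coe_add, Pi.add_apply]
  linarith

lemma osc_sub_le (x y z : sumZero d) : osc (x - z) ≤ osc (x - y) + osc (y - z) := by
  simpa using osc_add_le (x - y) (y - z)

lemma osc_neg (x : sumZero d) : osc (-x) = osc x := by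
  apply le_antisymm <;> rw [osc_le_iff] <;> intro i j
  · have := sub_le_osc x j i
    simp only [Submodule.coe_neg, Pi.neg_apply]
    linarith
  · have := sub_le_osc (-x) j i
    simp only [Submodule.coe_neg, Pi.neg_apply] at this
    linarith

lemma osc_sub_comm (x y : sumZero d) : osc (x - y) = osc (y - x) := by
  rw [← osc_neg, neg_sub]

lemma eq_zero_of_osc_le_zero {x : sumZero d} (h : osc x ≤ 0) : x = 0 := by
  rw [osc_le_iff] at h
  have hx : ∑ i, x.1 i = 0 := x.2
  ext i
  have hc : ∀ j, x.1 j = x.1 i := fun j => le_antisymm (by linarith [h j i]) (by linarith [h i j])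
  simp only [hc, Finset.sum_const, Finset.card_univ, Fintype.card_fin, nsmul_eq_mul] at hx
  simpa using (mul_eq_zero.mp hx).resolve_left (by positivity)

end Oscillation

/-! ### The lattice of vertices -/

/-- The lattice of all points of `V` with integral coordinate differences. It is the set of
vertices of the affine Coxeter complex. -/
def weightLattice (d : ℕ) : AddSubgroup (sumZero d) where
  carrier := {v | ∀ i j, ∃ m : ℤ, v.1 i - v.1 j = m}
  zero_mem' := fun _ _ => ⟨0, by simp⟩
  add_mem' := by
    intro u v hu hv i j
    obtain ⟨m, hm⟩ := hu i j
    obtain ⟨n, hn⟩ := hv i j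
    refine ⟨m + n, ?_⟩
    simp only [Submodule.coe_add, Pi.add_apply]
    push_cast
    linarith
  neg_mem' := by
    intro u hu i j
    obtain ⟨m, hm⟩ := hu j i
    refine ⟨m, ?_⟩
    simp only [Submodule.coe_neg, Pi.neg_apply]
    linarith

section Lattice

variable {d : ℕ}

lemma osc_le_of_lt_add_one {v : sumZero d} (hv : v ∈ weightLattice d) {n : ℕ}
    (h : osc v < n + 1) : osc v ≤ n := by
  rw [osc_lt_iff] at h
  rw [osc_le_iff]
  intro i j
  obtain ⟨m, hm⟩ := hv i j
  have := h i j
  rw [hm] at this ⊢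
  have h' : m < n + 1 := by exact_mod_cast this
  have h'' : m ≤ n := by omega
  exact_mod_cast h''

lemma one_le_osc {v : sumZero d} (hv : v ∈ weightLattice d) (h : v ≠ 0) : 1 ≤ osc v := by
  by_contra hlt
  push Not at hlt
  have := osc_le_of_lt_add_one (n := 0) hv (by simpa using hlt)
  exact h (eq_zero_of_osc_le_zero (by simpa using this))

/-- The projection of `ℝ^(d+1)` onto `V` along the diagonal. -/
noncomputable def diagProj (d : ℕ) : (Fin (d + 1) → ℝ) →ₗ[ℝ] sumZero d where
  toFun a := ⟨fun i => a i - (∑ j, a j) / (d + 1), by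
    have : (d : ℝ) + 1 ≠ 0 := by positivity
    simp only [sumZero, Submodule.mem_mk, AddSubmonoid.mem_mk, AddSubsemigroup.mem_mk,
      Set.mem_ofPred_eq, Finset.sum_sub_distrib, Finset.sum_const, Finset.card_univ,
      Fintype.card_fin, nsmul_eq_mul]
    push_cast
    field_simp
    ring⟩
  map_add' a b := by
    ext i
    simp [Finset.sum_add_distrib]
    ring
  map_smul' r a := by
    ext i
    simp [← Finset.mul_sum]
    ring

lemma diagProj_sub (a : Fin (d + 1) → ℝ) (i j : Fin (d + 1)) :
    (diagProj d a).1 i - (diagProj d a).1 j = a i - a j := by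
  simp [diagProj]

lemma diagProj_coe (x : sumZero d) : diagProj d x.1 = x := by
  have hx : ∑ i, x.1 i = 0 := x.2
  ext i
  simp [diagProj, hx]

lemma eq_of_sub_eq {x y : sumZero d} (h : ∀ i j, x.1 i - x.1 j = y.1 i - y.1 j) : x = y := by
  rw [← sub_eq_zero]
  apply eq_zero_of_osc_le_zero
  rw [osc_le_iff]
  intro i j
  have := h i j
  simp only [Submodule.coe_sub, Pi.sub_apply]
  linarith

/-- The projection along the diagonal, restricted to integer vectors. Its image is the lattice of
vertices. -/
noncomputable def latticeProj (d : ℕ) : (Fin (d + 1) → ℤ) →+ weightLattice d where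
  toFun a := ⟨diagProj d fun i => (a i : ℝ), fun i j => ⟨a i - a j, by simp [diagProj_sub]⟩⟩
  map_zero' := by
    ext : 1
    exact eq_of_sub_eq fun i j => by simp [diagProj_sub]
  map_add' a b := by
    ext : 1
    refine eq_of_sub_eq fun i j => ?_
    simp [diagProj]
    ring

lemma latticeProj_sub (a : Fin (d + 1) → ℤ) (i j : Fin (d + 1)) :
    (latticeProj d a).1.1 i - (latticeProj d a).1.1 j = (a i : ℝ) - a j :=
  diagProj_sub _ i j

lemma latticeProj_surjective : Function.Surjective (latticeProj d) := by
  intro v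
  choose a ha using fun i => v.2 i 0
  refine ⟨a, ?_⟩
  ext : 1
  refine eq_of_sub_eq fun i j => ?_
  rw [latticeProj_sub, ← ha, ← ha]
  ring

end Lattice

/-! ### Barycentric coordinates in the affine Coxeter complex -/

/-- The weights `c` on the lattice are barycentric coordinates of `x`: they are carried by pairwise
adjacent vertices (any two coordinates of a difference of adjacent vertices differ by at most one),
are non-negative with total mass one, and have centre of mass `x`. -/
structure IsBary {d : ℕ} (c : weightLattice d →₀ ℝ) (x : sumZero d) : Prop where
  nonneg : ∀ v, 0 ≤ c v
  adj : ∀ u ∈ c.support, ∀ v ∈ c.support, osc (u.1 - v.1) ≤ 1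
  total : (c.sum fun _ r => r) = 1
  center : (c.sum fun v r => r • v.1) = x

section Barycentric

variable {d : ℕ}

lemma sum_smul_coord {s : Finset (weightLattice d)} (c : weightLattice d → ℝ) (i : Fin (d + 1)) :
    (∑ u ∈ s, c u • u.1).1 i = ∑ u ∈ s, c u * u.1.1 i := by
  simp [Finset.sum_apply]

/-- The barycentric coordinate `c v` of a point `x` is determined by the oscillation of `x - v`.
The reason is that the coordinates of the differences `u - v`, for pairwise adjacent `u`, are
ordered consistently, so that the oscillation is additive on their non-negative combinations. -/
lemma osc_center_sub {s : Finset (weightLattice d)}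
    (hs : ∀ u ∈ s, ∀ v ∈ s, osc (u.1 - v.1) ≤ 1) {c : weightLattice d → ℝ} (hc : ∀ v, 0 ≤ c v)
    (h1 : ∑ v ∈ s, c v = 1) {v : weightLattice d} (hv : v ∈ s) :
    osc (∑ u ∈ s, c u • u.1 - v.1) = 1 - c v := by
  obtain ⟨i, j, hij⟩ := exists_sub_eq_osc (∑ u ∈ s, c u • u.1 - v.1)
  -- the difference of two coordinates of `u - v`
  set f : weightLattice d → Fin (d + 1) → Fin (d + 1) → ℝ :=
    fun u k l => (u.1.1 k - v.1.1 k) - (u.1.1 l - v.1.1 l) with hf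
  have hsum : ∀ k l, (∑ u ∈ s, c u • u.1 - v.1).1 k - (∑ u ∈ s, c u • u.1 - v.1).1 l
      = ∑ u ∈ s, c u * f u k l := by
    intro k l
    have : ∑ u ∈ s, c u * f u k l = ∑ u ∈ s, c u * u.1.1 k - ∑ u ∈ s, c u * u.1.1 l
        - (∑ u ∈ s, c u) * v.1.1 k + (∑ u ∈ s, c u) * v.1.1 l := by
      rw [Finset.sum_mul, Finset.sum_mul, ← Finset.sum_sub_distrib, ← Finset.sum_sub_distrib,
        ← Finset.sum_add_distrib]
      exact Finset.sum_congr rfl fun u _ => by simp only [hf]; ring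
    rw [this, h1]
    simp only [Submodule.coe_sub, Pi.sub_apply, sum_smul_coord]
    ring
  -- if one difference increases strictly from `k` to `l`, then no other one decreases
  have hcons : ∀ u ∈ s, ∀ k l, f u k l < 0 → ∀ w ∈ s, f w k l ≤ 0 := by
    intro u hu k l h w hw
    by_contra hlt
    push Not at hlt
    have hint : ∀ u : weightLattice d, ∃ m : ℤ, f u k l = m := by
      intro u
      obtain ⟨m, hm⟩ := (u - v).2 k l
      exact ⟨m, by simpa [hf] using hm⟩
    obtain ⟨m, hm⟩ := hint u
    obtain ⟨n, hn⟩ := hint w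
    have h2 := (osc_le_iff.mp (hs w hw u hu)) k l
    have h3 : (n : ℝ) - m ≤ 1 := by
      rw [← hm, ← hn]
      simp only [hf]
      simp only [Submodule.coe_sub, Pi.sub_apply] at h2
      linarith
    rw [hm] at h
    rw [hn] at hlt
    have h4 : m < 0 := by exact_mod_cast h
    have h5 : 0 < n := by exact_mod_cast hlt
    have h6 : n - m ≤ 1 := by exact_mod_cast h3
    omega
  have hmax : ∀ u ∈ s, 0 < c u → ∀ k l, f u k l < 0 → ∑ w ∈ s, c w * f w k l < 0 := by
    intro u hu hcu k l h
    exact Finset.sum_neg' (fun w hw => mul_nonpos_of_nonneg_of_nonpos (hc w) (hcons u hu k l h w hw))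
      ⟨u, hu, mul_neg_of_pos_of_neg hcu h⟩
  have hval : ∀ u ∈ s, u ≠ v → c u * f u i j = c u := by
    intro u hu huv
    rcases (hc u).eq_or_lt with h0 | hpos
    · simp [← h0]
    have hi : ∀ l, 0 ≤ f u i l := by
      intro l
      by_contra h
      push Not at h
      have h1 := hmax u hu hpos i l h
      rw [← hsum] at h1
      have h2 := sub_le_osc (∑ u ∈ s, c u • u.1 - v.1) l j
      linarith
    have hj : ∀ l, 0 ≤ f u l j := by
      intro l
      by_contra h
      push Not at h
      have h1 := hmax u hu hpos l j h
      rw [← hsum] at h1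
      have h2 := sub_le_osc (∑ u ∈ s, c u • u.1 - v.1) i l
      linarith
    have hle : f u i j ≤ 1 := by
      simpa [hf] using (osc_le_iff.mp (hs u hu v hv)) i j
    have hge : 1 ≤ f u i j := by
      refine (one_le_osc (u - v).2 ?_).trans ?_
      · simpa [sub_eq_zero] using huv
      · rw [osc_le_iff]
        intro k l
        have h1 := hi k
        have h2 := hj l
        simp only [hf, AddSubgroup.coe_sub, Submodule.coe_sub, Pi.sub_apply] at h1 h2 ⊢
        linarith
    rw [le_antisymm hle hge, mul_one]
  rw [← hij, hsum, ← Finset.add_sum_erase s _ hv,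
    Finset.sum_congr rfl fun u hu => hval u (Finset.mem_of_mem_erase hu) (Finset.ne_of_mem_erase hu),
    ← h1, ← Finset.add_sum_erase s c hv]
  simp [hf]

namespace IsBary

variable {c c' : weightLattice d →₀ ℝ} {x y : sumZero d}

lemma pos (h : IsBary c x) {v : weightLattice d} (hv : v ∈ c.support) : 0 < c v :=
  (h.nonneg v).lt_of_ne (Finsupp.mem_support_iff.mp hv).symm

lemma osc_sub (h : IsBary c x) {s : Finset (weightLattice d)} (hsub : c.support ⊆ s)
    (hs : ∀ u ∈ s, ∀ v ∈ s, osc (u.1 - v.1) ≤ 1) {v : weightLattice d} (hv : v ∈ s) :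
    osc (x - v.1) = 1 - c v := by
  have h1 : ∑ v ∈ s, c v = 1 := by
    rw [← h.total, Finsupp.sum_of_support_subset _ hsub _ (by simp)]
  have h2 : ∑ u ∈ s, c u • u.1 = x := by
    rw [← h.center, Finsupp.sum_of_support_subset _ hsub _ (by simp)]
  rw [← h2]
  exact osc_center_sub hs h.nonneg h1 hv

/-- The support of the barycentric coordinates of `x` consists of the lattice points at distance
less than one from `x`. -/
lemma mem_support_iff (h : IsBary c x) {v : weightLattice d} :
    v ∈ c.support ↔ osc (x - v.1) < 1 := by
  classical
  refine ⟨fun hv => ?_, fun hv => ?_⟩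
  · rw [h.osc_sub subset_rfl h.adj hv]
    linarith [h.pos hv]
  by_contra hnot
  -- otherwise `v` could be added to the simplex, where its coordinate is zero
  have hadj : ∀ u ∈ c.support, osc (u.1 - v.1) ≤ 1 := by
    intro u hu
    have h1 := h.osc_sub subset_rfl h.adj hu
    have h2 := osc_sub_le u.1 x v.1
    rw [osc_sub_comm u.1 x] at h2
    exact_mod_cast osc_le_of_lt_add_one (n := 1) (u - v).2 (by
      push_cast
      linarith [h.pos hu])
  have hs : ∀ u ∈ insert v c.support, ∀ w ∈ insert v c.support, osc (u.1 - w.1) ≤ 1 := by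
    intro u hu w hw
    have h0 : osc (v.1 - v.1) ≤ 1 := by simp [osc_le_iff]
    rcases Finset.mem_insert.mp hu with hu' | hu' <;>
      rcases Finset.mem_insert.mp hw with hw' | hw'
    · rwa [hu', hw']
    · rw [hu', osc_sub_comm]; exact hadj w hw'
    · rw [hw']; exact hadj u hu'
    · exact h.adj u hu' w hw'
  have := h.osc_sub (Finset.subset_insert _ _) hs (Finset.mem_insert_self v _)
  rw [Finsupp.notMem_support_iff.mp hnot] at this
  linarith

theorem unique (h : IsBary c x) (h' : IsBary c' x) : c = c' := by
  have hsupp : c.support = c'.support := by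
    ext v
    rw [h.mem_support_iff, h'.mem_support_iff]
  ext v
  by_cases hv : v ∈ c.support
  · have h1 := h.osc_sub subset_rfl h.adj hv
    have h2 := h'.osc_sub subset_rfl h'.adj (hsupp ▸ hv)
    linarith
  · rw [Finsupp.notMem_support_iff.mp hv, Finsupp.notMem_support_iff.mp (hsupp ▸ hv)]

lemma support_nonempty (h : IsBary c x) : c.support.Nonempty := by
  rw [Finset.nonempty_iff_ne_empty]
  intro h0
  have := h.total
  rw [Finsupp.sum, h0] at this
  simp at this

end IsBary

/-- A vector with entries in `[0, M]` is a non-negative combination, with total weight `M`, of the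
indicator vectors of a chain of sets. -/
lemma exists_chain_combination {ι : Type*} [Fintype ι] [DecidableEq ι] (n : ℕ) :
    ∀ (y : ι → ℝ) (M : ℝ), (Finset.univ.filter fun i => y i ≠ 0).card = n → (∀ i, 0 ≤ y i) →
      0 ≤ M → (∀ i, y i ≤ M) → ∃ c : Finset ι →₀ ℝ, (∀ A, 0 ≤ c A) ∧
        (∀ A ∈ c.support, ∀ B ∈ c.support, A ⊆ B ∨ B ⊆ A) ∧
        (∀ A ∈ c.support, ∀ i ∈ A, y i ≠ 0) ∧ (c.sum fun _ r => r) = M ∧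
        ∀ i, (c.sum fun A r => r * if i ∈ A then 1 else 0) = y i := by
  induction n using Nat.strong_induction_on with
  | _ n ih =>
    intro y M hn hy hM hyM
    set A := Finset.univ.filter fun i => y i ≠ 0 with hA
    rcases A.eq_empty_or_nonempty with h0 | hne
    · have hy0 : ∀ i, y i = 0 := by
        intro i
        by_contra h
        have : i ∈ A := by simp [hA, h]
        simp [h0] at this
      refine ⟨Finsupp.single ∅ M, ?_, ?_, ?_, by simp, by simp [hy0]⟩
      · intro B
        rw [Finsupp.single_apply]
        split_ifs <;> simp [hM]
      · intro B hB C hC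
        have := Finset.mem_singleton.mp (Finsupp.support_single_subset hB)
        left; simp [this]
      · intro B hB i hi
        have := Finset.mem_singleton.mp (Finsupp.support_single_subset hB)
        simp [this] at hi
    -- subtract the smallest positive entry from all positive entries
    obtain ⟨i₀, hi₀, hmin⟩ := A.exists_min_image y hne
    set y' : ι → ℝ := fun i => y i - if i ∈ A then y i₀ else 0 with hy'
    have hsub : (Finset.univ.filter fun i => y' i ≠ 0) ⊆ A.erase i₀ := by
      intro i hi
      simp only [Finset.mem_filter, Finset.mem_univ, true_and, hy'] at hi
      rw [Finset.mem_erase]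
      constructor
      · rintro rfl
        simp [hi₀] at hi
      · by_contra hiA
        have : y i = 0 := by simpa [hA] using hiA
        simp [hiA, this] at hi
    have hlt : (Finset.univ.filter fun i => y' i ≠ 0).card < n :=
      hn ▸ (Finset.card_le_card hsub).trans_lt (Finset.card_erase_lt_of_mem hi₀)
    obtain ⟨c, hc0, hchain, hcs, hctot, hcy⟩ := ih _ hlt y' (M - y i₀) rfl
      (by
        intro i
        simp only [hy']
        split_ifs with h
        · linarith [hmin i h]
        · linarith [hy i])
      (by linarith [hyM i₀])
      (by
        intro i
        simp only [hy']
        split_ifs with h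
        · linarith [hyM i]
        · have : y i = 0 := by simpa [hA] using h
          linarith [hyM i₀])
    have hcA : ∀ B ∈ c.support, B ⊆ A := fun B hB i hi =>
      Finset.mem_of_mem_erase (hsub (by simpa using hcs B hB i hi))
    have hmem : ∀ B ∈ (c + Finsupp.single A (y i₀)).support, B = A ∨ B ∈ c.support := by
      intro B hB
      rcases Finset.mem_union.mp (Finsupp.support_add hB) with h | h
      · exact Or.inr h
      · exact Or.inl (Finset.mem_singleton.mp (Finsupp.support_single_subset h))
    refine ⟨c + Finsupp.single A (y i₀), ?_, ?_, ?_, ?_, ?_⟩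
    · intro B
      rw [Finsupp.add_apply, Finsupp.single_apply]
      have := hc0 B
      have := hy i₀
      split_ifs <;> linarith
    · intro B hB C hC
      rcases hmem B hB with rfl | hB <;> rcases hmem C hC with rfl | hC
      · exact Or.inl subset_rfl
      · exact Or.inr (hcA C hC)
      · exact Or.inl (hcA B hB)
      · exact hchain B hB C hC
    · intro B hB i hi
      have : i ∈ A := by
        rcases hmem B hB with rfl | hB
        · exact hi
        · exact hcA B hB hi
      simpa [hA] using this
    · rw [Finsupp.sum_add_index' (by simp) (by simp), hctot, Finsupp.sum_single_index rfl]
      ring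
    · intro i
      rw [Finsupp.sum_add_index' (by simp) (by intros; ring), hcy,
        Finsupp.sum_single_index (by simp)]
      simp only [hy']
      split_ifs <;> ring

/-- Every point has barycentric coordinates: after subtraction of the integral parts, the entries
of the point lie in `[0, 1]`, and a chain of sets `A` yields pairwise adjacent vertices. -/
theorem exists_isBary (x : sumZero d) : ∃ c, IsBary c x := by
  classical
  obtain ⟨c, hc0, hchain, -, htot, hcy⟩ := exists_chain_combination _
    (fun i => Int.fract (x.1 i)) 1 rfl (fun i => Int.fract_nonneg _) zero_le_one
    (fun i => (Int.fract_lt_one _).le)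
  set P : Finset (Fin (d + 1)) → weightLattice d :=
    fun A => latticeProj d fun i => ⌊x.1 i⌋ + if i ∈ A then 1 else 0 with hP
  have hadj : ∀ A B : Finset (Fin (d + 1)), A ⊆ B ∨ B ⊆ A → osc ((P A).1 - (P B).1) ≤ 1 := by
    intro A B hAB
    rw [osc_le_iff]
    intro i j
    have h1 := latticeProj_sub (fun i => ⌊x.1 i⌋ + if i ∈ A then 1 else 0) i j
    have h2 := latticeProj_sub (fun i => ⌊x.1 i⌋ + if i ∈ B then 1 else 0) i j
    simp only [hP, Submodule.coe_sub, Pi.sub_apply]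
    suffices h : ((if i ∈ A then 1 else 0 : ℝ) - (if j ∈ A then 1 else 0)) -
        ((if i ∈ B then 1 else 0) - (if j ∈ B then 1 else 0)) ≤ 1 by
      push_cast at h1 h2
      linarith
    rcases hAB with h | h
    · have hi := @h i
      have hj := @h j
      by_cases i ∈ A <;> by_cases j ∈ A <;> by_cases i ∈ B <;> by_cases j ∈ B <;> simp_all
    · have hi := @h i
      have hj := @h j
      by_cases i ∈ A <;> by_cases j ∈ A <;> by_cases i ∈ B <;> by_cases j ∈ B <;> simp_all
  refine ⟨c.mapDomain P, ?_, ?_, ?_, ?_⟩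
  · intro v
    rw [Finsupp.mapDomain, Finsupp.sum_apply]
    refine Finset.sum_nonneg fun A _ => ?_
    dsimp only
    rw [Finsupp.single_apply]
    split_ifs
    · exact hc0 A
    · exact le_rfl
  · intro u hu v hv
    obtain ⟨A, hA, rfl⟩ := Finset.mem_image.mp (Finsupp.mapDomain_support hu)
    obtain ⟨B, hB, rfl⟩ := Finset.mem_image.mp (Finsupp.mapDomain_support hv)
    exact hadj A B (hchain A hA B hB)
  · rw [Finsupp.sum_mapDomain_index (by simp) (by simp), htot]
  · rw [Finsupp.sum_mapDomain_index (by simp) (by intros; rw [add_smul])]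
    have hproj : ∀ A, (P A).1 = diagProj d fun i => (⌊x.1 i⌋ : ℝ) + if i ∈ A then 1 else 0 := by
      intro A
      simp [hP, latticeProj]
    simp only [hproj, Finsupp.sum, ← map_smul, ← map_sum]
    conv_rhs => rw [← diagProj_coe x]
    congr 1
    ext i
    have h1 := hcy i
    simp only [Finsupp.sum] at h1 htot
    simp only [Finset.sum_apply, Pi.smul_apply, smul_eq_mul, mul_add, Finset.sum_add_distrib,
      ← Finset.sum_mul, h1, htot, one_mul, Int.floor_add_fract]

/-- The barycentric coordinates of a point of `V` in the affine Coxeter complex. -/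
noncomputable def bary (x : sumZero d) : weightLattice d →₀ ℝ :=
  (exists_isBary x).choose

lemma isBary_bary (x : sumZero d) : IsBary (bary x) x :=
  (exists_isBary x).choose_spec

lemma mem_support_bary {x : sumZero d} {v : weightLattice d} :
    v ∈ (bary x).support ↔ osc (x - v.1) < 1 :=
  (isBary_bary x).mem_support_iff

lemma IsBary.bary_eq {c : weightLattice d →₀ ℝ} {x : sumZero d} (h : IsBary c x) : bary x = c :=
  (isBary_bary x).unique h

lemma support_bary_nonempty (x : sumZero d) : (bary x).support.Nonempty :=
  (isBary_bary x).support_nonempty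

end Barycentric

/-! ### The faces of the affine Coxeter complex -/

section Faces

variable {d : ℕ}

/-- The closed cell of `x` is cut out by the weak inequalities, between coordinate differences and
integers, that hold at `x`. -/
lemma mem_closure_coxeterCell {x y : sumZero d} : y ∈ closure (coxeterCell d x) ↔
    ∀ i j, ∀ m : ℤ, x.1 j - x.1 i ≤ m → y.1 j - y.1 i ≤ m := by
  have hcont : ∀ i : Fin (d + 1), Continuous fun z : sumZero d => z.1 i :=
    fun i => (continuous_apply i).comp continuous_subtype_val
  constructor
  · intro hy i j m hm
    have hclosed : IsClosed {z : sumZero d | z.1 j - z.1 i ≤ m} :=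
      isClosed_le ((hcont j).sub (hcont i)) continuous_const
    refine closure_minimal (fun z hz => ?_) hclosed hy
    rcases lt_trichotomy i j with h | rfl | h
    · have h1 := hz i j h m
      have h2 : SignType.sign (x.1 j - x.1 i - m) ≤ 0 := by
        rw [sign_nonpos_iff]
        linarith
      rw [← h1, sign_nonpos_iff] at h2
      simpa using h2
    · simpa using hm
    · have h1 := hz j i h (-m)
      have h2 : 0 ≤ SignType.sign (x.1 i - x.1 j - (-m : ℤ)) := by
        rw [sign_nonneg_iff]
        push_cast
        linarith
      rw [← h1, sign_nonneg_iff] at h2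
      push_cast at h2
      simp only [Set.mem_ofPred_eq]
      linarith
  · intro h
    -- the half-open segment from `x` to `y` lies in the open cell of `x`
    have hlim : Filter.Tendsto (fun t : ℝ => (1 - t) • y + t • x) (nhdsWithin 0 (Set.Ioi 0))
        (nhds y) := by
      have : Continuous fun t : ℝ => (1 - t) • y + t • x := by fun_prop
      have h0 := this.tendsto 0
      simp only [sub_zero, one_smul, zero_smul, add_zero] at h0
      exact h0.mono_left nhdsWithin_le_nhds
    refine mem_closure_of_tendsto hlim ?_
    filter_upwards [Ioo_mem_nhdsGT (show (0 : ℝ) < 1 by norm_num)] with t ht i j _ m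
    have hval : ((1 - t) • y + t • x).1 j - ((1 - t) • y + t • x).1 i - m
        = (1 - t) * (y.1 j - y.1 i - m) + t * (x.1 j - x.1 i - m) := by
      simp only [Submodule.coe_add, Submodule.coe_smul, Pi.add_apply, Pi.smul_apply, smul_eq_mul]
      ring
    have h1 := h i j m
    have h2 := h j i (-m)
    push_cast at h2
    have ht0 := ht.1
    have ht1 : 0 < 1 - t := by linarith [ht.2]
    rcases lt_trichotomy (x.1 j - x.1 i - m) 0 with hx | hx | hx
    · rw [sign_neg hx, sign_neg]
      rw [hval]
      have := h1 (by linarith)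
      nlinarith
    · have e1 := h1 (by linarith)
      have e2 := h2 (by linarith)
      have hy0 : y.1 j - y.1 i - m = 0 := by linarith
      rw [hval, hx, hy0]
      simp
    · rw [sign_pos hx, sign_pos]
      rw [hval]
      have := h2 (by linarith)
      nlinarith

lemma IsBary.coord_eq_sum {c : weightLattice d →₀ ℝ} {x : sumZero d} (h : IsBary c x)
    (i : Fin (d + 1)) : x.1 i = ∑ v ∈ c.support, c v * v.1.1 i := by
  rw [← sum_smul_coord]
  conv_lhs => rw [← h.center]
  rfl

/-- A face of the affine Coxeter complex consists of the points whose barycentric coordinates are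
carried by the vertices of the face. -/
theorem mem_closure_coxeterCell_iff_support_subset {x y : sumZero d} :
    y ∈ closure (coxeterCell d x) ↔ (bary y).support ⊆ (bary x).support := by
  rw [mem_closure_coxeterCell]
  constructor
  · intro h v hv
    rw [mem_support_bary, osc_lt_iff] at hv ⊢
    intro i j
    by_contra hlt
    push Not at hlt
    obtain ⟨m, hm⟩ := v.2 i j
    have h1 := hv i j
    have h2 := h i j (-(m + 1))
    simp only [Submodule.coe_sub, Pi.sub_apply] at h1 hlt
    push_cast at h2
    have h3 := h2 (by linarith)
    linarith
  · intro h i j m hm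
    have hc := isBary_bary y
    have htot := hc.total
    simp only [Finsupp.sum] at htot
    rw [hc.coord_eq_sum, hc.coord_eq_sum, ← Finset.sum_sub_distrib, ← one_mul (m : ℝ), ← htot,
      Finset.sum_mul]
    refine Finset.sum_le_sum fun v hv => ?_
    rw [← mul_sub]
    refine mul_le_mul_of_nonneg_left ?_ (hc.nonneg v)
    have h1 := osc_lt_iff.mp (mem_support_bary.mp (h hv)) i j
    obtain ⟨n, hn⟩ := v.2 j i
    simp only [Submodule.coe_sub, Pi.sub_apply] at h1
    rw [hn]
    have : (n : ℝ) < m + 1 := by linarith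
    have : n < m + 1 := by exact_mod_cast this
    exact_mod_cast Int.lt_add_one_iff.mp this

lemma bary_vertex (v : weightLattice d) : bary v.1 = Finsupp.single v 1 := by
  have hs : ∀ u ∈ (Finsupp.single v (1 : ℝ)).support, u = v := fun u hu =>
    Finset.mem_singleton.mp (Finsupp.support_single_subset hu)
  apply IsBary.bary_eq
  refine ⟨fun u => ?_, fun u hu w hw => ?_, by simp, by simp⟩
  · rw [Finsupp.single_apply]
    split_ifs <;> norm_num
  · rw [hs u hu, hs w hw]
    simp [osc_le_iff]

lemma support_bary_vertex (v : weightLattice d) : (bary v.1).support = {v} := by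
  rw [bary_vertex, Finsupp.support_single _ one_ne_zero]

lemma eq_vertex_of_support_eq {x : sumZero d} {v : weightLattice d}
    (h : (bary x).support = {v}) : x = v.1 := by
  have hb := isBary_bary x
  have h1 := hb.total
  have h2 := hb.center
  simp only [Finsupp.sum, h, Finset.sum_singleton] at h1 h2
  rw [← h2, h1, one_smul]

lemma closure_coxeterCell_vertex (v : weightLattice d) :
    closure (coxeterCell d v.1) = {v.1} := by
  ext y
  rw [mem_closure_coxeterCell_iff_support_subset, support_bary_vertex, Set.mem_singleton_iff]
  constructor
  · intro h
    rcases Finset.subset_singleton_iff.mp h with h | h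
    · exact absurd h (support_bary_nonempty y).ne_empty
    · exact eq_vertex_of_support_eq h
  · rintro rfl
    rw [support_bary_vertex]

lemma vertex_mem_closure_coxeterCell {x : sumZero d} {v : weightLattice d} :
    v.1 ∈ closure (coxeterCell d x) ↔ v ∈ (bary x).support := by
  rw [mem_closure_coxeterCell_iff_support_subset, support_bary_vertex, Finset.singleton_subset_iff]

theorem mem_coxeterVertices {x : sumZero d} : x ∈ coxeterVertices d ↔ x ∈ weightLattice d := by
  constructor
  · rintro ⟨y, hy⟩
    obtain ⟨v, hv⟩ := support_bary_nonempty y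
    have := vertex_mem_closure_coxeterCell.mpr hv
    rw [← hy, Set.mem_singleton_iff] at this
    rw [← this]
    exact v.2
  · intro hx
    exact ⟨x, (closure_coxeterCell_vertex ⟨x, hx⟩).symm⟩

lemma closure_coxeterCell_subset_iff {x y : sumZero d} :
    closure (coxeterCell d x) ⊆ closure (coxeterCell d y) ↔
      (bary x).support ⊆ (bary y).support := by
  constructor
  · intro h
    rw [← mem_closure_coxeterCell_iff_support_subset]
    exact h (mem_closure_coxeterCell_iff_support_subset.mpr subset_rfl)
  · intro h z hz
    rw [mem_closure_coxeterCell_iff_support_subset] at hz ⊢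
    exact hz.trans h

lemma bary_add (l : weightLattice d) (x : sumZero d) :
    bary (l.1 + x) = (bary x).mapDomain fun v => l + v := by
  classical
  have hb := isBary_bary x
  have hinj : Function.Injective fun v : weightLattice d => l + v := add_right_injective l
  apply IsBary.bary_eq
  refine ⟨fun v => ?_, ?_, ?_, ?_⟩
  · obtain ⟨w, rfl⟩ : ∃ w, l + w = v := ⟨-l + v, by simp⟩
    rw [Finsupp.mapDomain_apply hinj]
    exact hb.nonneg w
  · intro u hu v hv
    obtain ⟨u, hu', rfl⟩ := Finset.mem_image.mp (Finsupp.mapDomain_support hu)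
    obtain ⟨v, hv', rfl⟩ := Finset.mem_image.mp (Finsupp.mapDomain_support hv)
    simpa using hb.adj u hu' v hv'
  · rw [Finsupp.sum_mapDomain_index (by simp) (by simp), hb.total]
  · rw [Finsupp.sum_mapDomain_index (by simp) (by intros; rw [add_smul])]
    have h1 := hb.total
    have h2 := hb.center
    simp only [Finsupp.sum] at h1 h2 ⊢
    simp only [AddSubgroup.coe_add, smul_add, Finset.sum_add_distrib, ← Finset.sum_smul, h1, h2,
      one_smul]

lemma mem_support_bary_add {l v : weightLattice d} {x : sumZero d} :
    v ∈ (bary (l.1 + x)).support ↔ -l + v ∈ (bary x).support := by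
  rw [mem_support_bary, mem_support_bary]
  have : l.1 + x - v.1 = x - (-l + v : weightLattice d).1 := by
    simp only [AddSubgroup.coe_add, AddSubgroup.coe_neg]
    abel
  rw [this]

lemma vadd_closure_coxeterCell (l : weightLattice d) (x : sumZero d) :
    l.1 +ᵥ closure (coxeterCell d x) = closure (coxeterCell d (l.1 + x)) := by
  ext y
  rw [Set.mem_vadd_set_iff_neg_vadd_mem, mem_closure_coxeterCell_iff_support_subset,
    mem_closure_coxeterCell_iff_support_subset, vadd_eq_add]
  constructor
  · intro h v hv
    rw [mem_support_bary_add]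
    refine h ?_
    have := (mem_support_bary_add (l := -l) (v := -l + v) (x := y)).mpr (by simpa using hv)
    simpa using this
  · intro h v hv
    have h1 := (mem_support_bary_add (l := -l) (v := v) (x := y)).mp (by simpa using hv)
    have h2 := mem_support_bary_add.mp (h h1)
    simpa using h2

end Faces

/-! ### Arithmetic of the sublattice -/

section Sublattice

variable {d : ℕ} {k : Fin (d + 1) → ℕ}

lemma vecMul_heawoodMatrix (b : Fin (d + 1) → ℤ) (j : Fin (d + 1)) :
    Matrix.vecMul b (heawoodMatrix k) j = b j + k j * (b j - b (j - 1)) := by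
  have h : ∀ i, (j = i + 1) ↔ (i = j - 1) := fun i =>
    ⟨fun h => by rw [h, add_sub_cancel_right], fun h => by rw [h, sub_add_cancel]⟩
  simp only [Matrix.vecMul, dotProduct, heawoodMatrix, Matrix.of_apply, mul_sub,
    Finset.sum_sub_distrib, h, mul_ite, mul_zero, Finset.sum_ite_eq, Finset.sum_ite_eq',
    Finset.mem_univ, if_true]
  ring

lemma vecMul_heawoodMatrix_const (c : ℤ) :
    Matrix.vecMul (fun _ => c) (heawoodMatrix k) = fun _ => c := by
  ext j
  simp [vecMul_heawoodMatrix]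

lemma sum_smul_weightVector (a : Fin (d + 1) → ℤ) :
    ∑ i, (a i : ℝ) • weightVector d i = (latticeProj d a).1.1 := by
  ext j
  simp [weightVector, latticeProj, diagProj, Finset.sum_apply, mul_sub, Pi.single_apply,
    div_eq_mul_inv, ← Finset.sum_mul]

lemma mem_subLattice {x : sumZero d} : x ∈ subLattice k ↔
    ∃ b : Fin (d + 1) → ℤ, x = (latticeProj d (Matrix.vecMul b (heawoodMatrix k))).1 := by
  refine exists_congr fun b => ?_
  rw [sum_smul_weightVector, SetLike.coe_eq_coe]

lemma subLattice_le_weightLattice : subLattice k ≤ weightLattice d := by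
  intro x hx
  obtain ⟨b, rfl⟩ := mem_subLattice.mp hx
  exact (latticeProj d _).2

open Fin.CommRing in
lemma cyclic_induction {P : Fin (d + 1) → Prop} (hP : ∀ j, P (j - 1) → P j) {i : Fin (d + 1)}
    (hi : P i) (j : Fin (d + 1)) : P j := by
  have h : ∀ n : ℕ, P (i + (n : Fin (d + 1))) := by
    intro n
    induction n with
    | zero => simpa using hi
    | succ n ih =>
      apply hP
      rw [Nat.cast_succ, ← add_assoc, add_sub_cancel_right]
      exact ih
  have := h (j - i).val
  rwa [Fin.cast_val_eq_self, add_sub_cancel] at this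

/-- If `b M` has entries in `{0, 1, 2}`, then `b` is constant. A comparison at the largest and the
smallest entries of `b` shows that `b` has entries in `{0, 1, 2}`. A step of `b` can then only lead
from `0` or `2` to `1`, and never leaves the value `1`. -/
lemma eq_of_vecMul_mem_Icc (hk : ∀ i, 1 ≤ k i) {b : Fin (d + 1) → ℤ}
    (h0 : ∀ j, 0 ≤ Matrix.vecMul b (heawoodMatrix k) j)
    (h2 : ∀ j, Matrix.vecMul b (heawoodMatrix k) j ≤ 2) (i j : Fin (d + 1)) : b i = b j := by
  simp only [vecMul_heawoodMatrix] at h0 h2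
  have hk' : ∀ j, (1 : ℤ) ≤ k j := fun j => by exact_mod_cast hk j
  obtain ⟨p, -, hp⟩ := Finset.univ.exists_max_image b Finset.univ_nonempty
  obtain ⟨q, -, hq⟩ := Finset.univ.exists_min_image b Finset.univ_nonempty
  have hp2 : b p ≤ 2 := by
    have h := hp (p - 1) (Finset.mem_univ _)
    nlinarith [h2 p, hk' p]
  have hq0 : 0 ≤ b q := by
    have h := hq (q - 1) (Finset.mem_univ _)
    nlinarith [h0 q, hk' q]
  have hb0 : ∀ j, 0 ≤ b j := fun j => hq0.trans (hq j (Finset.mem_univ _))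
  have hb2 : ∀ j, b j ≤ 2 := fun j => (hp j (Finset.mem_univ _)).trans hp2
  have hstep : ∀ j, b j = b (j - 1) ∨ b j = 1 ∧ b (j - 1) ≠ 1 := by
    intro j
    have e0 := h0 j
    have e2 := h2 j
    have e3 := hk' j
    have e4 := hb0 j
    have e5 := hb2 j
    have e6 := hb0 (j - 1)
    have e7 := hb2 (j - 1)
    generalize b j = s at *
    generalize b (j - 1) = t at *
    interval_cases s <;> interval_cases t <;> omega
  by_cases hone : ∃ l, b l = 1
  · obtain ⟨l, hl⟩ := hone
    have hall : ∀ j, b j = 1 :=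
      cyclic_induction (P := fun j => b j = 1) (fun j h => by rcases hstep j with h' | h' <;> omega)
        hl
    rw [hall i, hall j]
  · push Not at hone
    exact (cyclic_induction (P := fun l => b l = b i)
      (fun j h => ((hstep j).resolve_right fun h' => hone j h'.1).trans h) rfl j).symm

/-- Distinct points of the sublattice are at distance at least three. This is what makes the
quotient a genuine simplicial complex. -/
theorem eq_zero_of_osc_le_two (hk : ∀ i, 1 ≤ k i) {x : sumZero d} (hx : x ∈ subLattice k)
    (h : osc x ≤ 2) : x = 0 := by
  obtain ⟨b, rfl⟩ := mem_subLattice.mp hx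
  set a := Matrix.vecMul b (heawoodMatrix k) with ha
  obtain ⟨p, -, hp⟩ := Finset.univ.exists_min_image a Finset.univ_nonempty
  -- subtracting a constant from `b` subtracts the same constant from `b M`
  have hb : Matrix.vecMul (b - fun _ => a p) (heawoodMatrix k) = a - fun _ => a p := by
    rw [Matrix.sub_vecMul, vecMul_heawoodMatrix_const]
  have hconst := eq_of_vecMul_mem_Icc hk (b := b - fun _ => a p)
    (fun j => by
      rw [hb]
      have := hp j (Finset.mem_univ _)
      simp only [Pi.sub_apply]
      omega)
    (fun j => by
      rw [hb]
      have h1 := osc_le_iff.mp h j p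
      rw [latticeProj_sub] at h1
      simp only [Pi.sub_apply]
      exact_mod_cast h1)
  have hbc : b = fun _ => b 0 := by
    ext j
    have := hconst j 0
    simpa using this
  refine eq_of_sub_eq fun i j => ?_
  rw [latticeProj_sub, ha, hbc, vecMul_heawoodMatrix_const]
  simp

end Sublattice

/-! ### The faces and vertices of the quotient complex -/

section Quotient

variable {d : ℕ} {k : Fin (d + 1) → ℕ}

/-- The smallest face of the affine Coxeter complex that contains `x`. -/
def carrierFace (x : sumZero d) : coxeterFaces d :=
  ⟨closure (coxeterCell d x), x, rfl⟩

lemma exists_eq_carrierFace (F : coxeterFaces d) : ∃ x, F = carrierFace x := by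
  obtain ⟨F, x, rfl⟩ := F
  exact ⟨x, rfl⟩

lemma closure_coxeterCell_eq_iff {x y : sumZero d} :
    closure (coxeterCell d x) = closure (coxeterCell d y) ↔
      (bary x).support = (bary y).support := by
  rw [Set.Subset.antisymm_iff, closure_coxeterCell_subset_iff, closure_coxeterCell_subset_iff,
    Finset.Subset.antisymm_iff]

lemma torusFace_mk_eq_iff {F G : coxeterFaces d} : TorusFace.mk k F = TorusFace.mk k G ↔
    ∃ v ∈ subLattice k, (G : Set (sumZero d)) = v +ᵥ (F : Set (sumZero d)) :=
  Quotient.eq (r := faceSetoid k)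

lemma torusFace_mk_carrierFace_eq_iff {x y : sumZero d} :
    TorusFace.mk k (carrierFace x) = TorusFace.mk k (carrierFace y) ↔
      ∃ l : weightLattice d, l.1 ∈ subLattice k ∧
        (bary (l.1 + x)).support = (bary y).support := by
  rw [torusFace_mk_eq_iff]
  constructor
  · rintro ⟨v, hv, h⟩
    refine ⟨⟨v, subLattice_le_weightLattice hv⟩, hv, ?_⟩
    rw [← closure_coxeterCell_eq_iff, ← vadd_closure_coxeterCell]
    exact h.symm
  · rintro ⟨l, hl, h⟩
    refine ⟨l.1, hl, ?_⟩
    rw [← closure_coxeterCell_eq_iff, ← vadd_closure_coxeterCell] at h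
    exact h.symm

lemma torusFace_mk_carrierFace_add {l : weightLattice d} (hl : l.1 ∈ subLattice k)
    (x : sumZero d) :
    TorusFace.mk k (carrierFace (l.1 + x)) = TorusFace.mk k (carrierFace x) :=
  (torusFace_mk_carrierFace_eq_iff.mpr ⟨l, hl, rfl⟩).symm

lemma torusFace_mk_le_iff {x y : sumZero d} :
    TorusFace.mk k (carrierFace x) ≤ TorusFace.mk k (carrierFace y) ↔
      ∃ l : weightLattice d, l.1 ∈ subLattice k ∧
        (bary (l.1 + x)).support ⊆ (bary y).support := by
  constructor
  · rintro ⟨F, G, hF, hG, hsub⟩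
    obtain ⟨x', rfl⟩ := exists_eq_carrierFace F
    obtain ⟨y', rfl⟩ := exists_eq_carrierFace G
    obtain ⟨l, hl, hlx⟩ := torusFace_mk_carrierFace_eq_iff.mp hF
    obtain ⟨m, hm, hmy⟩ := torusFace_mk_carrierFace_eq_iff.mp hG
    have hsub' : (bary x').support ⊆ (bary y').support := closure_coxeterCell_subset_iff.mp hsub
    refine ⟨m - l, (subLattice k).sub_mem hm hl, fun v hv => ?_⟩
    rw [mem_support_bary_add, ← hlx, mem_support_bary_add] at hv
    rw [← hmy, mem_support_bary_add]
    refine hsub' ?_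
    convert hv using 1
    abel
  · rintro ⟨l, hl, h⟩
    exact ⟨carrierFace (l.1 + x), carrierFace y, torusFace_mk_carrierFace_add hl x, rfl,
      closure_coxeterCell_subset_iff.mpr h⟩

/-- The class of a vertex of the affine Coxeter complex, as a vertex of the quotient complex. -/
def vertexClass (k : Fin (d + 1) → ℕ) (v : weightLattice d) : TorusVertex k :=
  ⟨TorusFace.mk k ⟨{v.1}, mem_coxeterVertices.mpr v.2⟩, ⟨v.1, mem_coxeterVertices.mpr v.2⟩, rfl⟩

lemma vertexClass_val (v : weightLattice d) :
    (vertexClass k v).1 = TorusFace.mk k (carrierFace v.1) := by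
  simp only [vertexClass, carrierFace, closure_coxeterCell_vertex]

lemma vertexClass_surjective : Function.Surjective (vertexClass k) := by
  rintro ⟨c, x, rfl⟩
  exact ⟨⟨x.1, mem_coxeterVertices.mp x.2⟩, rfl⟩

lemma vertexClass_eq_iff {u v : weightLattice d} :
    vertexClass k u = vertexClass k v ↔ v.1 - u.1 ∈ subLattice k := by
  refine Subtype.ext_iff.trans (torusFace_mk_eq_iff.trans ?_)
  simp only [Set.vadd_set_singleton, Set.singleton_eq_singleton_iff, vadd_eq_add]
  constructor
  · rintro ⟨w, hw, h⟩
    rwa [h, add_sub_cancel_right]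
  · exact fun h => ⟨_, h, by abel⟩

lemma vertexClass_add {l : weightLattice d} (hl : l.1 ∈ subLattice k) (v : weightLattice d) :
    vertexClass k (l + v) = vertexClass k v := by
  rw [vertexClass_eq_iff]
  simpa using (subLattice k).neg_mem hl

lemma vertexClass_le_iff {v : weightLattice d} {x : sumZero d} :
    (vertexClass k v).1 ≤ TorusFace.mk k (carrierFace x) ↔
      ∃ u ∈ (bary x).support, vertexClass k u = vertexClass k v := by
  rw [vertexClass_val, torusFace_mk_le_iff]
  constructor
  · rintro ⟨l, hl, h⟩
    refine ⟨l + v, h ?_, vertexClass_add hl v⟩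
    rw [← AddSubgroup.coe_add, support_bary_vertex]
    simp
  · rintro ⟨u, hu, h⟩
    rw [eq_comm, vertexClass_eq_iff] at h
    refine ⟨u - v, h, ?_⟩
    rw [← AddSubgroup.coe_add, support_bary_vertex]
    simpa using hu

/-- Distinct vertices of a face of the affine Coxeter complex have distinct classes. -/
lemma vertexClass_injOn (hk : ∀ i, 1 ≤ k i) (x : sumZero d) :
    Set.InjOn (vertexClass k) (bary x).support := by
  intro u hu v hv h
  have h1 := (isBary_bary x).adj v hv u hu
  have h2 := eq_zero_of_osc_le_two hk (vertexClass_eq_iff.mp h) (by linarith)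
  exact (Subtype.ext (sub_eq_zero.mp h2)).symm

/-- A face of the quotient complex is determined by its vertices: if all vertices of one face
are equivalent to vertices of another one, then a single translation moves the first face into the
second, because the sublattice has no short vectors. -/
theorem exists_translate_subset (hk : ∀ i, 1 ≤ k i) {x y : sumZero d}
    (h : ∀ v ∈ (bary x).support, ∃ u ∈ (bary y).support, vertexClass k u = vertexClass k v) :
    ∃ l : weightLattice d, l.1 ∈ subLattice k ∧
      (bary (l.1 + x)).support ⊆ (bary y).support := by
  obtain ⟨v₀, hv₀⟩ := support_bary_nonempty x
  obtain ⟨u₀, hu₀, h₀⟩ := h v₀ hv₀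
  rw [eq_comm, vertexClass_eq_iff] at h₀
  refine ⟨u₀ - v₀, h₀, fun w hw => ?_⟩
  rw [mem_support_bary_add] at hw
  obtain ⟨u, hu, hcl⟩ := h _ hw
  rw [eq_comm, vertexClass_eq_iff] at hcl
  have hmem : u.1 - w.1 ∈ subLattice k := by
    have := (subLattice k).sub_mem hcl h₀
    convert this using 1
    simp only [AddSubgroup.coe_add, AddSubgroup.coe_neg, AddSubgroup.coe_sub]
    abel
  have h1 := (isBary_bary y).adj u hu u₀ hu₀
  have h2 := (isBary_bary x).adj v₀ hv₀ _ hw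
  have h3 := osc_sub_le u.1 u₀.1 w.1
  have h4 : v₀.1 - (-(u₀ - v₀) + w : weightLattice d).1 = u₀.1 - w.1 := by
    simp only [AddSubgroup.coe_add, AddSubgroup.coe_neg, AddSubgroup.coe_sub]
    abel
  rw [h4] at h2
  have := eq_zero_of_osc_le_two hk hmem (by linarith)
  rwa [← Subtype.ext (sub_eq_zero.mp this)]

lemma torusFace_le_iff_vertices (hk : ∀ i, 1 ≤ k i) {c c' : TorusFace k} :
    c ≤ c' ↔ {v : TorusVertex k | v.1 ≤ c} ⊆ {v | v.1 ≤ c'} := by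
  obtain ⟨F, rfl⟩ := Quotient.exists_rep c
  obtain ⟨G, rfl⟩ := Quotient.exists_rep c'
  obtain ⟨x, rfl⟩ := exists_eq_carrierFace F
  obtain ⟨y, rfl⟩ := exists_eq_carrierFace G
  change TorusFace.mk k (carrierFace x) ≤ TorusFace.mk k (carrierFace y) ↔
    {v : TorusVertex k | v.1 ≤ TorusFace.mk k (carrierFace x)} ⊆
      {v | v.1 ≤ TorusFace.mk k (carrierFace y)}
  constructor
  · intro h v hv
    obtain ⟨l, hl, hsub⟩ := torusFace_mk_le_iff.mp h
    obtain ⟨v, rfl⟩ := vertexClass_surjective v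
    obtain ⟨u, hu, huv⟩ := vertexClass_le_iff.mp hv
    refine vertexClass_le_iff.mpr ⟨l + u, hsub ?_, (vertexClass_add hl u).trans huv⟩
    rw [mem_support_bary_add]
    simpa using hu
  · intro h
    rw [torusFace_mk_le_iff]
    refine exists_translate_subset hk fun v hv => ?_
    exact vertexClass_le_iff.mp (h (vertexClass_le_iff.mpr ⟨v, hv, rfl⟩))

lemma torusFace_le_antisymm {c c' : TorusFace k} (h : c ≤ c') (h' : c' ≤ c) : c = c' := by
  obtain ⟨F, rfl⟩ := Quotient.exists_rep c
  obtain ⟨G, rfl⟩ := Quotient.exists_rep c'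
  obtain ⟨x, rfl⟩ := exists_eq_carrierFace F
  obtain ⟨y, rfl⟩ := exists_eq_carrierFace G
  obtain ⟨l, hl, hsub⟩ := torusFace_mk_le_iff.mp h
  obtain ⟨m, hm, hsub'⟩ := torusFace_mk_le_iff.mp h'
  refine torusFace_mk_carrierFace_eq_iff.mpr ⟨l, hl, Finset.eq_of_subset_of_card_le hsub ?_⟩
  have hcard : ∀ (l : weightLattice d) (x : sumZero d),
      (bary (l.1 + x)).support.card = (bary x).support.card := by
    intro l x
    rw [bary_add, Finsupp.mapDomain_support_of_injective (add_right_injective l),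
      Finset.card_image_of_injective _ (add_right_injective l)]
  rw [hcard]
  rw [← hcard m]
  exact Finset.card_le_card hsub'

end Quotient

/-! ### The number of vertices -/

section Determinant

variable {d : ℕ} {k : Fin (d + 1) → ℕ}

/-- The determinant is positive: multiplication of the cyclic off-diagonal part by `t ∈ [0, 1]`
joins the matrix to a diagonal one through matrices that are strictly dominated by the diagonal in
each column, hence regular. -/
theorem det_heawoodMatrix_pos : 0 < (heawoodMatrix k).det := by
  set A : ℝ → Matrix (Fin (d + 1)) (Fin (d + 1)) ℝ := fun t => Matrix.of fun i j =>
    (if j = i then (k j : ℝ) + 1 else 0) - (if j = i + 1 then t * k j else 0) with hA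
  have h1 : A 1 = (heawoodMatrix k).map (Int.castRingHom ℝ) := by
    ext i j
    simp only [hA, heawoodMatrix, Matrix.of_apply, Matrix.map_apply, one_mul]
    split_ifs <;> simp
  have h0 : A 0 = Matrix.diagonal fun j => (k j : ℝ) + 1 := by
    ext i j
    by_cases h : j = i
    · simp [hA, h]
    · simp [hA, h, Matrix.diagonal_apply_ne' _ h]
  have hvec : ∀ t (b : Fin (d + 1) → ℝ) j,
      Matrix.vecMul b (A t) j = b j * (k j + 1) - t * k j * b (j - 1) := by
    intro t b j
    have h : ∀ i, (j = i + 1) ↔ (i = j - 1) := fun i =>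
      ⟨fun h => by rw [h, add_sub_cancel_right], fun h => by rw [h, sub_add_cancel]⟩
    simp only [hA, Matrix.vecMul, dotProduct, Matrix.of_apply, mul_sub,
      Finset.sum_sub_distrib, h, mul_ite, mul_zero, Finset.sum_ite_eq, Finset.sum_ite_eq',
      Finset.mem_univ, if_true]
    ring
  have hne : ∀ t ∈ Set.Icc (0 : ℝ) 1, (A t).det ≠ 0 := by
    rintro t ⟨ht0, ht1⟩ hdet
    obtain ⟨b, hb, hbA⟩ := Matrix.exists_vecMul_eq_zero_iff.mpr hdet
    obtain ⟨p, -, hp⟩ := Finset.univ.exists_max_image (fun j => |b j|) Finset.univ_nonempty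
    have hpos : 0 < |b p| := by
      obtain ⟨j, hj⟩ := Function.ne_iff.mp hb
      exact (abs_pos.mpr hj).trans_le (hp j (Finset.mem_univ _))
    have h2 := congrFun hbA p
    rw [hvec, Pi.zero_apply, sub_eq_zero] at h2
    have h3 := congrArg abs h2
    have hkp : (0 : ℝ) ≤ k p := by positivity
    rw [abs_mul, abs_mul, abs_mul, abs_of_nonneg ht0, abs_of_nonneg hkp,
      abs_of_nonneg (by linarith : (0 : ℝ) ≤ k p + 1)] at h3
    have h4 : t * k p * |b (p - 1)| ≤ 1 * k p * |b p| := by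
      have := hp (p - 1) (Finset.mem_univ _)
      gcongr
    nlinarith
  have hcont : Continuous fun t => (A t).det := by
    refine Continuous.matrix_det (continuous_pi fun i => continuous_pi fun j => ?_)
    simp only [hA, Matrix.of_apply]
    split_ifs <;> fun_prop
  have hdet0 : 0 < (A 0).det := by
    rw [h0, Matrix.det_diagonal]
    exact Finset.prod_pos fun j _ => by positivity
  have hdet1 : 0 < (A 1).det := by
    by_contra hle
    push Not at hle
    obtain ⟨t, ht, h⟩ := intermediate_value_Icc' zero_le_one hcont.continuousOn
      (Set.mem_Icc.mpr ⟨hle, hdet0.le⟩)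
    exact hne t ht h
  have hmap : (A 1).det = ((heawoodMatrix k).det : ℝ) := by
    rw [h1, ← RingHom.mapMatrix_apply, ← RingHom.map_det]
    rfl
  rw [hmap] at hdet1
  exact_mod_cast hdet1

lemma index_range_vecMul {n : Type*} [Fintype n] [DecidableEq n] (M : Matrix n n ℤ)
    (hM : M.det ≠ 0) :
    (LinearMap.range (Matrix.vecMulLinear M)).toAddSubgroup.index = M.det.natAbs := by
  have hinj : Function.Injective (Matrix.vecMulLinear M) :=
    (injective_iff_map_eq_zero _).mpr fun _ h => Matrix.eq_zero_of_vecMul_eq_zero hM h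
  rw [AddSubgroup.index_eq_natAbs_det (Pi.basisFun ℤ n) _
    ((Pi.basisFun ℤ n).map (LinearEquiv.ofInjective _ hinj)), Pi.basisFun_det_apply]
  congr 2
  ext i j
  change Matrix.vecMul (Pi.basisFun ℤ n i) M j = M i j
  simp

/-- The vertices of the quotient complex are the integer vectors modulo the row space of the
matrix, which contains the diagonal. -/
theorem card_torusVertex : Nat.card (TorusVertex k) = (heawoodMatrix k).det.natAbs := by
  rw [← index_range_vecMul _ det_heawoodMatrix_pos.ne']
  set N := (LinearMap.range (Matrix.vecMulLinear (heawoodMatrix k))).toAddSubgroup with hN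
  have hrel : ∀ a b : Fin (d + 1) → ℤ, vertexClass k (latticeProj d a) =
      vertexClass k (latticeProj d b) ↔ -a + b ∈ N := by
    intro a b
    rw [vertexClass_eq_iff, ← AddSubgroup.coe_sub, ← map_sub, mem_subLattice]
    constructor
    · rintro ⟨v, hv⟩
      -- two integer vectors with the same projection differ by a constant vector
      refine ⟨v + fun _ => (b 0 - a 0) - Matrix.vecMul v (heawoodMatrix k) 0, ?_⟩
      rw [Matrix.vecMulLinear_apply, Matrix.add_vecMul, vecMul_heawoodMatrix_const]
      ext j
      have h1 := latticeProj_sub (b - a) j 0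
      rw [hv, latticeProj_sub] at h1
      have h2 : Matrix.vecMul v (heawoodMatrix k) j - Matrix.vecMul v (heawoodMatrix k) 0
          = (b j - a j) - (b 0 - a 0) := by exact_mod_cast h1
      simp only [Pi.add_apply, Pi.neg_apply]
      omega
    · rintro ⟨v, hv⟩
      refine ⟨v, ?_⟩
      rw [Matrix.vecMulLinear_apply] at hv
      rw [hv, neg_add_eq_sub]
  rw [AddSubgroup.index]
  symm
  refine Nat.card_congr (Equiv.ofBijective (Quotient.lift
    (fun a => vertexClass k (latticeProj d a)) fun a b h =>
      (hrel a b).mpr (QuotientAddGroup.leftRel_apply.mp h)) ⟨?_, ?_⟩)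
  · rintro ⟨a⟩ ⟨b⟩ h
    exact Quotient.sound (QuotientAddGroup.leftRel_apply.mpr ((hrel a b).mp h))
  · intro v
    obtain ⟨u, rfl⟩ := vertexClass_surjective v
    obtain ⟨a, rfl⟩ := latticeProj_surjective u
    exact ⟨Quotient.mk _ a, rfl⟩

theorem finite_torusVertex : Finite (TorusVertex k) :=
  Nat.finite_of_card_ne_zero (by
    rw [card_torusVertex]
    exact Int.natAbs_ne_zero.mpr det_heawoodMatrix_pos.ne')

end Determinant

/-! ### The quotient of `V` as a torus -/

section Torus

variable {d : ℕ}

/-- The coordinates of `x` in the basis of `V` formed by the projections of all rows of the matrix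
but the first one. They are differences of the entries of the row vector `x M⁻¹`, because the rows
sum to a vector on the diagonal. -/
noncomputable def rowCoord (k : Fin (d + 1) → ℕ) (x : sumZero d) (j : Fin d) : ℝ :=
  Matrix.vecMul x.1 ((heawoodMatrix k).map (Int.cast : ℤ → ℝ))⁻¹ j.succ -
    Matrix.vecMul x.1 ((heawoodMatrix k).map (Int.cast : ℤ → ℝ))⁻¹ 0

variable {k : Fin (d + 1) → ℕ}

lemma isUnit_det_heawoodMatrix_map : IsUnit ((heawoodMatrix k).map (Int.cast : ℤ → ℝ)).det := by
  have : ((heawoodMatrix k).map (Int.cast : ℤ → ℝ)).det = ((heawoodMatrix k).det : ℝ) := by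
    have := RingHom.map_det (Int.castRingHom ℝ) (heawoodMatrix k)
    exact this.symm
  rw [this, isUnit_iff_ne_zero]
  exact_mod_cast det_heawoodMatrix_pos.ne'

lemma vecMul_map_intCast (b : Fin (d + 1) → ℤ) (j : Fin (d + 1)) :
    Matrix.vecMul (fun i => (b i : ℝ)) ((heawoodMatrix k).map (Int.cast : ℤ → ℝ)) j =
      (Matrix.vecMul b (heawoodMatrix k) j : ℤ) := by
  simp [Matrix.vecMul, dotProduct]

lemma vecMul_map_const (c : ℝ) :
    Matrix.vecMul (fun _ => c) ((heawoodMatrix k).map (Int.cast : ℤ → ℝ)) = fun _ => c := by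
  have h1 : Matrix.vecMul (fun _ => (1 : ℝ)) ((heawoodMatrix k).map (Int.cast : ℤ → ℝ)) =
      fun _ => 1 := by
    ext j
    have := vecMul_map_intCast (k := k) (fun _ => 1) j
    rw [vecMul_heawoodMatrix_const] at this
    simpa using this
  have h2 : (fun _ : Fin (d + 1) => c) = c • fun _ => (1 : ℝ) := by
    ext
    simp
  rw [h2, Matrix.smul_vecMul, h1]

lemma rowCoord_diagProj (z : Fin (d + 1) → ℝ) (j : Fin d) :
    rowCoord k (diagProj d (Matrix.vecMul z ((heawoodMatrix k).map (Int.cast : ℤ → ℝ)))) j =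
      z j.succ - z 0 := by
  set A := (heawoodMatrix k).map (Int.cast : ℤ → ℝ) with hA
  set m := (∑ j, Matrix.vecMul z A j) / (d + 1) with hm
  have h : (diagProj d (Matrix.vecMul z A)).1 = Matrix.vecMul (z - fun _ => m) A := by
    rw [Matrix.sub_vecMul, vecMul_map_const]
    ext i
    simp [diagProj, hm]
  rw [rowCoord, ← hA, h, Matrix.vecMul_vecMul,
    Matrix.mul_nonsing_inv _ isUnit_det_heawoodMatrix_map, Matrix.vecMul_one]
  simp

lemma exists_eq_diagProj_vecMul (x : sumZero d) : ∃ z : Fin (d + 1) → ℝ,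
    x = diagProj d (Matrix.vecMul z ((heawoodMatrix k).map (Int.cast : ℤ → ℝ))) := by
  refine ⟨Matrix.vecMul x.1 ((heawoodMatrix k).map (Int.cast : ℤ → ℝ))⁻¹, ?_⟩
  rw [Matrix.vecMul_vecMul, Matrix.nonsing_inv_mul _ isUnit_det_heawoodMatrix_map,
    Matrix.vecMul_one, diagProj_coe]

lemma mem_subLattice_iff_rowCoord {x : sumZero d} :
    x ∈ subLattice k ↔ ∀ j, ∃ n : ℤ, rowCoord k x j = n := by
  constructor
  · intro hx j
    obtain ⟨b, rfl⟩ := mem_subLattice.mp hx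
    refine ⟨b j.succ - b 0, ?_⟩
    have h : (latticeProj d (Matrix.vecMul b (heawoodMatrix k))).1 = diagProj d
        (Matrix.vecMul (fun i => (b i : ℝ)) ((heawoodMatrix k).map (Int.cast : ℤ → ℝ))) := by
      simp only [latticeProj, AddMonoidHom.coe_mk, ZeroHom.coe_mk]
      congr 1
      ext i
      rw [vecMul_map_intCast]
    rw [h, rowCoord_diagProj]
    push_cast
    rfl
  · intro h
    choose n hn using h
    obtain ⟨z, rfl⟩ := exists_eq_diagProj_vecMul (k := k) x
    simp only [rowCoord_diagProj] at hn
    rw [mem_subLattice]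
    refine ⟨Fin.cons 0 n, eq_of_sub_eq fun i j => ?_⟩
    have hz : z = (fun i => ((Fin.cons 0 n : Fin (d + 1) → ℤ) i : ℝ)) + fun _ => z 0 := by
      ext i
      refine Fin.cases ?_ (fun i => ?_) i
      · simp
      · simp only [Pi.add_apply, Fin.cons_succ, ← hn]
        ring
    rw [hz, Matrix.add_vecMul, vecMul_map_const, latticeProj_sub, diagProj_sub]
    simp only [Pi.add_apply, vecMul_map_intCast]
    ring

/-- The homomorphism from `V` onto the torus that reduces the row coordinates modulo one. -/
noncomputable def toTorus (k : Fin (d + 1) → ℕ) : sumZero d →+ UnitAddTorus (Fin d) where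
  toFun x j := (rowCoord k x j : UnitAddCircle)
  map_zero' := by
    ext j
    simp [rowCoord]
  map_add' x y := by
    ext j
    rw [Pi.add_apply, ← AddCircle.coe_add]
    congr 1
    simp only [rowCoord, Submodule.coe_add, Matrix.add_vecMul, Pi.add_apply]
    ring

lemma toTorus_eq_zero_iff {x : sumZero d} : toTorus k x = 0 ↔ x ∈ subLattice k := by
  rw [mem_subLattice_iff_rowCoord, funext_iff]
  refine forall_congr' fun j => ?_
  change ((rowCoord k x j : ℝ) : UnitAddCircle) = 0 ↔ _
  rw [AddCircle.coe_eq_zero_iff]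
  simp [eq_comm]

lemma continuous_toTorus : Continuous (toTorus k) := by
  refine continuous_pi fun j => ?_
  change Continuous fun x : sumZero d => ((rowCoord k x j : ℝ) : UnitAddCircle)
  refine (AddCircle.continuous_mk' 1).comp ?_
  have h : ∀ i, Continuous fun x : sumZero d =>
      Matrix.vecMul x.1 ((heawoodMatrix k).map (Int.cast : ℤ → ℝ))⁻¹ i :=
    continuous_pi_iff.mp (continuous_subtype_val.matrix_vecMul continuous_const)
  exact (h _).sub (h _)

lemma toTorus_surjective : Function.Surjective (toTorus k) := by
  intro θ
  choose c hc using fun j => QuotientAddGroup.mk_surjective (θ j)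
  refine ⟨diagProj d (Matrix.vecMul (Fin.cons 0 c) ((heawoodMatrix k).map (Int.cast : ℤ → ℝ))), ?_⟩
  ext j
  change ((rowCoord k _ j : ℝ) : UnitAddCircle) = θ j
  rw [rowCoord_diagProj, ← hc]
  simp

/-- The continuous bijection from the quotient of `V` by the sublattice to the torus. -/
noncomputable def quotientToTorus (k : Fin (d + 1) → ℕ) :
    sumZero d ⧸ subLattice k →+ UnitAddTorus (Fin d) :=
  QuotientAddGroup.lift (subLattice k) (toTorus k) fun _ hx => toTorus_eq_zero_iff.mpr hx

lemma continuous_quotientToTorus : Continuous (quotientToTorus k) :=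
  continuous_toTorus.quotient_lift _

lemma quotientToTorus_bijective : Function.Bijective (quotientToTorus k) := by
  constructor
  · rw [injective_iff_map_eq_zero]
    intro a ha
    obtain ⟨x, rfl⟩ := QuotientAddGroup.mk_surjective a
    rw [QuotientAddGroup.eq_zero_iff]
    exact toTorus_eq_zero_iff.mp ha
  · intro θ
    obtain ⟨x, rfl⟩ := toTorus_surjective (k := k) θ
    exact ⟨x, rfl⟩

instance instT2SpaceQuotientSubLattice : T2Space (sumZero d ⧸ subLattice k) :=
  T2Space.of_injective_continuous quotientToTorus_bijective.1 continuous_quotientToTorus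

end Torus

/-! ### The simplicial complex and its realization -/

section Realization

lemma isCompact_closedSimplex {ι : Type*} (s : Finset ι) : IsCompact (closedSimplex s) := by
  refine (isCompact_univ_pi fun _ : ι => isCompact_Icc (a := (0 : ℝ)) (b := 1)).of_isClosed_subset
    ?_ ?_
  · have h1 : IsClosed {t : ι → ℝ | ∀ v, 0 ≤ t v} := by
      simp only [Set.ofPred_forall]
      exact isClosed_iInter fun v => isClosed_le continuous_const (continuous_apply v)
    have h2 : IsClosed {t : ι → ℝ | ∀ v, v ∉ s → t v = 0} := by
      simp only [Set.ofPred_forall]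
      exact isClosed_iInter fun v => isClosed_iInter fun _ =>
        isClosed_eq (continuous_apply v) continuous_const
    have h3 : IsClosed {t : ι → ℝ | ∑ v ∈ s, t v = 1} :=
      isClosed_eq (continuous_finsetSum _ fun v _ => continuous_apply v) continuous_const
    exact h1.inter (h2.inter h3)
  · rintro t ⟨h1, h2, h3⟩ v -
    refine ⟨h1 v, ?_⟩
    by_cases hv : v ∈ s
    · rw [← h3]
      exact Finset.single_le_sum (fun w _ => h1 w) hv
    · rw [h2 v hv]
      exact zero_le_one

lemma Realization.continuous_ofFace {ι : Type*} (K : AbstractSimplicialComplex ι)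
    (s : {s // s ∈ K.faces}) : Continuous (Realization.ofFace K s) :=
  continuous_iSup_rng (i := s) continuous_coinduced_rng

lemma Realization.continuous_iff {ι Y : Type*} [TopologicalSpace Y]
    {K : AbstractSimplicialComplex ι} {f : Realization K → Y} :
    Continuous f ↔ ∀ s, Continuous (f ∘ Realization.ofFace K s) := by
  rw [continuous_iSup_dom]
  simp only [continuous_coinduced_dom]

instance Realization.instCompactSpace {ι : Type*} [Finite ι] (K : AbstractSimplicialComplex ι) :
    CompactSpace (Realization K) := by
  have hcover : (Set.univ : Set (Realization K)) = ⋃ s, Set.range (Realization.ofFace K s) := by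
    ext p
    obtain ⟨s, hs, hp⟩ := p.mem_simplex
    simp only [Set.mem_univ, Set.mem_iUnion, true_iff]
    exact ⟨⟨s, hs⟩, ⟨p.coord, hp⟩, rfl⟩
  refine ⟨?_⟩
  rw [hcover]
  refine isCompact_iUnion fun s => ?_
  have := isCompact_iff_compactSpace.mp (isCompact_closedSimplex s.1)
  exact isCompact_range (Realization.continuous_ofFace K s)

end Realization

section Complex

/-- The barycentric coordinates on a set of pairwise adjacent vertices that are prescribed by a
weight. -/
lemma isBary_indicator {d : ℕ} {s : Finset (weightLattice d)}
    (hs : ∀ u ∈ s, ∀ v ∈ s, osc (u.1 - v.1) ≤ 1) {t : weightLattice d → ℝ}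
    (ht : ∀ v ∈ s, 0 ≤ t v) (htot : ∑ v ∈ s, t v = 1) :
    IsBary (Finsupp.indicator s fun v _ => t v) (∑ v ∈ s, t v • v.1) := by
  have hsub := Finsupp.support_indicator_subset s fun v _ => t v
  have hval : ∀ v ∈ s, Finsupp.indicator s (fun v _ => t v) v = t v := fun v hv =>
    Finsupp.indicator_of_mem hv _
  refine ⟨fun v => ?_, fun u hu v hv => hs u (hsub hu) v (hsub hv), ?_, ?_⟩
  · by_cases hv : v ∈ s
    · rw [hval v hv]
      exact ht v hv
    · rw [Finsupp.indicator_of_notMem hv]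
  · rw [Finsupp.sum_of_support_subset _ hsub _ (by simp), ← htot]
    exact Finset.sum_congr rfl hval
  · rw [Finsupp.sum_of_support_subset _ hsub _ (by simp)]
    exact Finset.sum_congr rfl fun v hv => by rw [hval v hv]

/-- Every non-empty set of pairwise adjacent vertices is the vertex set of a face. -/
lemma exists_support_bary_eq {d : ℕ} {s : Finset (weightLattice d)} (hne : s.Nonempty)
    (hs : ∀ u ∈ s, ∀ v ∈ s, osc (u.1 - v.1) ≤ 1) : ∃ x, (bary x).support = s := by
  classical
  have hcard : (0 : ℝ) < s.card := by exact_mod_cast hne.card_pos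
  have hb := isBary_indicator hs (t := fun _ => (1 : ℝ) / s.card) (fun _ _ => by positivity)
    (by
      rw [Finset.sum_const, nsmul_eq_mul]
      field_simp)
  refine ⟨∑ v ∈ s, ((1 : ℝ) / s.card) • v.1, Finset.ext fun v => ?_⟩
  rw [hb.bary_eq, Finsupp.mem_support_iff]
  by_cases hv : v ∈ s
  · rw [Finsupp.indicator_of_mem hv]
    simp [hv, hne.ne_empty]
  · rw [Finsupp.indicator_of_notMem hv]
    simp [hv]

variable {d : ℕ} {k : Fin (d + 1) → ℕ}

instance instFiniteTorusVertex : Finite (TorusVertex k) :=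
  finite_torusVertex

/-- The set of vertices of a face of the quotient complex. -/
noncomputable def faceVertices (c : TorusFace k) : Finset (TorusVertex k) :=
  (Set.toFinite {v : TorusVertex k | v.1 ≤ c}).toFinset

lemma coe_faceVertices (c : TorusFace k) :
    (faceVertices c : Set (TorusVertex k)) = {v | v.1 ≤ c} := by
  simp [faceVertices]

open Classical in
lemma faceVertices_mk (x : sumZero d) :
    faceVertices (TorusFace.mk k (carrierFace x)) = (bary x).support.image (vertexClass k) := by
  ext v
  obtain ⟨v, rfl⟩ := vertexClass_surjective v
  rw [← Finset.mem_coe, coe_faceVertices, Set.mem_ofPred_eq, vertexClass_le_iff, Finset.mem_image]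

lemma exists_eq_mk_carrierFace (c : TorusFace k) : ∃ x, c = TorusFace.mk k (carrierFace x) := by
  obtain ⟨F, rfl⟩ := Quotient.exists_rep c
  obtain ⟨x, rfl⟩ := exists_eq_carrierFace F
  exact ⟨x, rfl⟩

variable (k) in
/-- The abstract simplicial complex of the vertex sets of the faces of the quotient complex. -/
noncomputable def torusComplex : AbstractSimplicialComplex (TorusVertex k) where
  faces := Set.range faceVertices
  isRelLowerSet_faces := by
    classical
    rintro _ ⟨c, rfl⟩
    obtain ⟨x, rfl⟩ := exists_eq_mk_carrierFace c
    rw [faceVertices_mk]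
    refine ⟨(support_bary_nonempty x).image _, fun T hT hne => ?_⟩
    obtain ⟨S, hS, rfl⟩ := Finset.subset_image_iff.mp hT
    obtain ⟨y, rfl⟩ := exists_support_bary_eq (Finset.image_nonempty.mp hne)
      fun u hu v hv => (isBary_bary x).adj u (hS hu) v (hS hv)
    exact ⟨_, faceVertices_mk y⟩
  singleton_mem := by
    classical
    intro v
    obtain ⟨v, rfl⟩ := vertexClass_surjective v
    exact ⟨TorusFace.mk k (carrierFace v.1), by rw [faceVertices_mk, support_bary_vertex]; rfl⟩

lemma faceVertices_subset_iff (hk : ∀ i, 1 ≤ k i) {c c' : TorusFace k} :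
    faceVertices c ⊆ faceVertices c' ↔ c ≤ c' := by
  rw [torusFace_le_iff_vertices hk, ← Finset.coe_subset, coe_faceVertices, coe_faceVertices]

lemma faceVertices_injective (hk : ∀ i, 1 ≤ k i) :
    Function.Injective (faceVertices (k := k)) := fun _ _ h =>
  torusFace_le_antisymm ((faceVertices_subset_iff hk).mp h.subset)
    ((faceVertices_subset_iff hk).mp h.symm.subset)

/-- The isomorphism from the classes of faces to the faces of the simplicial complex. -/
noncomputable def torusFaceIso (hk : ∀ i, 1 ≤ k i) :
    TorusFace k ≃o {s // s ∈ (torusComplex k).faces} where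
  toEquiv := Equiv.ofInjective faceVertices (faceVertices_injective hk)
  map_rel_iff' := faceVertices_subset_iff hk

/-! ### The homeomorphism between the realization and the quotient of `V` -/

/-- Barycentric coordinates of `x`, transported to the quotient complex. -/
noncomputable def torusBary (k : Fin (d + 1) → ℕ) (x : sumZero d) : TorusVertex k →₀ ℝ :=
  (bary x).mapDomain (vertexClass k)

lemma torusBary_vertexClass (hk : ∀ i, 1 ≤ k i) {x y : sumZero d}
    (h : (bary x).support ⊆ (bary y).support) {v : weightLattice d} (hv : v ∈ (bary y).support) :
    torusBary k x (vertexClass k v) = bary x v :=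
  Finsupp.mapDomain_apply' _ _ (by exact_mod_cast h) (vertexClass_injOn hk y) hv

lemma torusBary_mem_closedSimplex (hk : ∀ i, 1 ≤ k i) {x y : sumZero d} :
    ⇑(torusBary k x) ∈ closedSimplex (faceVertices (TorusFace.mk k (carrierFace y))) ↔
      ∀ v ∈ (bary x).support, ∃ u ∈ (bary y).support, vertexClass k u = vertexClass k v := by
  classical
  rw [faceVertices_mk]
  constructor
  · rintro ⟨-, h, -⟩ v hv
    by_contra hnot
    have h0 := h (vertexClass k v) (by simpa using hnot)
    rw [torusBary_vertexClass hk subset_rfl hv] at h0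
    exact Finsupp.mem_support_iff.mp hv h0
  · intro h
    have hsupp : (torusBary k x).support ⊆ (bary y).support.image (vertexClass k) := by
      intro w hw
      obtain ⟨v, hv, rfl⟩ := Finset.mem_image.mp (Finsupp.mapDomain_support hw)
      obtain ⟨u, hu, huv⟩ := h v hv
      exact Finset.mem_image.mpr ⟨u, hu, huv⟩
    refine ⟨fun w => ?_, fun w hw => ?_, ?_⟩
    · rw [torusBary, Finsupp.mapDomain, Finsupp.sum_apply]
      refine Finset.sum_nonneg fun v _ => ?_
      dsimp only
      rw [Finsupp.single_apply]
      split_ifs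
      · exact (isBary_bary x).nonneg v
      · exact le_rfl
    · exact Finsupp.notMem_support_iff.mp fun h' => hw (hsupp h')
    · have h1 : ((torusBary k x).sum fun _ r => r) = 1 := by
        rw [torusBary, Finsupp.sum_mapDomain_index (by simp) (by simp), (isBary_bary x).total]
      rw [← h1, Finsupp.sum_of_support_subset _ hsupp _ (by simp)]

lemma torusBary_add {l : weightLattice d} (hl : l.1 ∈ subLattice k) (x : sumZero d) :
    torusBary k (l.1 + x) = torusBary k x := by
  rw [torusBary, bary_add, ← Finsupp.mapDomain_comp, torusBary]
  congr 1
  ext v : 1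
  exact vertexClass_add hl v

lemma torusBary_eq_iff (hk : ∀ i, 1 ≤ k i) {x y : sumZero d} :
    torusBary k x = torusBary k y ↔ -x + y ∈ subLattice k := by
  constructor
  · intro h
    have hmem := (torusBary_mem_closedSimplex hk (x := y) (y := y)).mpr fun v hv => ⟨v, hv, rfl⟩
    rw [← h, torusBary_mem_closedSimplex hk] at hmem
    obtain ⟨l, hl, hsub⟩ := exists_translate_subset hk hmem
    have hb : bary (l.1 + x) = bary y := by
      ext v
      by_cases hv : v ∈ (bary y).support
      · rw [← torusBary_vertexClass hk hsub hv, ← torusBary_vertexClass hk subset_rfl hv,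
          torusBary_add hl, h]
      · rw [Finsupp.notMem_support_iff.mp hv,
          Finsupp.notMem_support_iff.mp fun h' => hv (hsub h')]
    have hxy : l.1 + x = y := by
      rw [← (isBary_bary (l.1 + x)).center, hb, (isBary_bary y).center]
    rw [← hxy]
    simpa using hl
  · intro h
    have := torusBary_add (l := ⟨-x + y, subLattice_le_weightLattice h⟩) h x
    rw [← this]
    congr 1
    simp

/-- The point of the realization given by the barycentric coordinates of a point of `V`. -/
noncomputable def realize (hk : ∀ i, 1 ≤ k i) (x : sumZero d) : Realization (torusComplex k) :=
  ⟨torusBary k x, _, ⟨TorusFace.mk k (carrierFace x), rfl⟩,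
    (torusBary_mem_closedSimplex hk).mpr fun v hv => ⟨v, hv, rfl⟩⟩

lemma realize_eq_iff (hk : ∀ i, 1 ≤ k i) {x y : sumZero d} :
    realize hk x = realize hk y ↔ -x + y ∈ subLattice k := by
  rw [← torusBary_eq_iff hk, Realization.ext_iff]
  exact DFunLike.coe_fn_eq

/-- The affine parametrization of the carrier face of `x` by the corresponding closed simplex of
the quotient complex. -/
noncomputable def faceChart (k : Fin (d + 1) → ℕ) (x : sumZero d) (t : TorusVertex k → ℝ) :
    sumZero d :=
  ∑ v ∈ (bary x).support, t (vertexClass k v) • v.1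

lemma continuous_faceChart (x : sumZero d) : Continuous (faceChart k x) :=
  continuous_finsetSum _ fun _ _ => (continuous_apply _).smul continuous_const

lemma faceChart_spec (hk : ∀ i, 1 ≤ k i) {x : sumZero d} {t : TorusVertex k → ℝ}
    (ht : t ∈ closedSimplex (faceVertices (TorusFace.mk k (carrierFace x)))) :
    faceChart k x t ∈ closure (coxeterCell d x) ∧ ⇑(torusBary k (faceChart k x t)) = t := by
  classical
  rw [faceVertices_mk] at ht
  obtain ⟨h0, hout, htot⟩ := ht
  rw [Finset.sum_image (vertexClass_injOn hk x)] at htot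
  have hb := isBary_indicator (isBary_bary x).adj
    (t := fun v => t (vertexClass k v)) (fun v _ => h0 _) htot
  change IsBary _ (faceChart k x t) at hb
  have hsub : (bary (faceChart k x t)).support ⊆ (bary x).support := by
    rw [hb.bary_eq]
    exact Finsupp.support_indicator_subset _ _
  refine ⟨mem_closure_coxeterCell_iff_support_subset.mpr hsub, ?_⟩
  ext w
  by_cases hw : w ∈ (bary x).support.image (vertexClass k)
  · obtain ⟨v, hv, rfl⟩ := Finset.mem_image.mp hw
    rw [torusBary_vertexClass hk hsub hv, hb.bary_eq, Finsupp.indicator_of_mem hv]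
  · rw [hout w hw]
    refine Finsupp.notMem_support_iff.mp fun h' => hw ?_
    obtain ⟨v, hv, rfl⟩ := Finset.mem_image.mp (Finsupp.mapDomain_support h')
    exact Finset.mem_image_of_mem _ (hsub hv)

/-- The bijection from the quotient of `V` to the realization that is induced by barycentric
coordinates. -/
noncomputable def quotientEquivRealization (hk : ∀ i, 1 ≤ k i) :
    (sumZero d ⧸ subLattice k) ≃ Realization (torusComplex k) :=
  Equiv.ofBijective (Quotient.lift (realize hk) fun _ _ h =>
    (realize_eq_iff hk).mpr (QuotientAddGroup.leftRel_apply.mp h)) (by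
      constructor
      · rintro ⟨x⟩ ⟨y⟩ h
        exact Quotient.sound (QuotientAddGroup.leftRel_apply.mpr ((realize_eq_iff hk).mp h))
      · rintro ⟨t, s, ⟨c, rfl⟩, ht⟩
        obtain ⟨x, rfl⟩ := exists_eq_mk_carrierFace c
        exact ⟨QuotientAddGroup.mk (faceChart k x t),
          Realization.ext (faceChart_spec hk ht).2⟩)

lemma quotientEquivRealization_mk (hk : ∀ i, 1 ≤ k i) (x : sumZero d) :
    quotientEquivRealization hk (QuotientAddGroup.mk x) = realize hk x :=
  rfl

lemma continuous_quotientEquivRealization_symm (hk : ∀ i, 1 ≤ k i) :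
    Continuous (quotientEquivRealization hk).symm := by
  rw [Realization.continuous_iff]
  rintro ⟨_, c, rfl⟩
  obtain ⟨x, rfl⟩ := exists_eq_mk_carrierFace c
  have h : (quotientEquivRealization hk).symm ∘ Realization.ofFace (torusComplex k)
      ⟨faceVertices (TorusFace.mk k (carrierFace x)), _, rfl⟩ =
      fun t => QuotientAddGroup.mk (faceChart k x t.1) := by
    ext t
    rw [Function.comp_apply, Equiv.symm_apply_eq, quotientEquivRealization_mk]
    exact Realization.ext (faceChart_spec hk t.2).2.symm
  rw [h]
  exact QuotientAddGroup.continuous_mk.comp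
    ((continuous_faceChart x).comp continuous_subtype_val)

/-- The realization of the quotient complex is homeomorphic to the quotient of `V`: the inverse of
the bijection given by barycentric coordinates is affine on each simplex, hence continuous, and it
maps a compact space to a Hausdorff space. -/
noncomputable def realizationHomeo (hk : ∀ i, 1 ≤ k i) :
    Realization (torusComplex k) ≃ₜ (sumZero d ⧸ subLattice k) :=
  (continuous_quotientEquivRealization_symm hk).homeoOfEquivCompactToT2

lemma realizationHomeo_realize (hk : ∀ i, 1 ≤ k i) (x : sumZero d) :
    realizationHomeo hk (realize hk x) = QuotientAddGroup.mk x := by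
  change (quotientEquivRealization hk).symm _ = _
  rw [Equiv.symm_apply_eq, quotientEquivRealization_mk]

lemma realizationHomeo_image (hk : ∀ i, 1 ≤ k i) (x : sumZero d) :
    realizationHomeo hk ''
      {p | p.coord ∈ closedSimplex (faceVertices (TorusFace.mk k (carrierFace x)))} =
      (QuotientAddGroup.mk : sumZero d → sumZero d ⧸ subLattice k) '' closure (coxeterCell d x) := by
  ext a
  constructor
  · rintro ⟨p, hp, rfl⟩
    obtain ⟨hmem, ht⟩ := faceChart_spec hk hp
    refine ⟨_, hmem, ?_⟩
    rw [← realizationHomeo_realize hk]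
    exact congrArg _ (Realization.ext ht)
  · rintro ⟨y, hy, rfl⟩
    refine ⟨realize hk y, ?_, realizationHomeo_realize hk y⟩
    rw [mem_closure_coxeterCell_iff_support_subset] at hy
    exact (torusBary_mem_closedSimplex hk).mpr fun v hv => ⟨v, hy hv, rfl⟩

theorem nonempty_realization_homeo_torus (hk : ∀ i, 1 ≤ k i) :
    Nonempty (Realization (torusComplex k) ≃ₜ UnitAddTorus (Fin d)) := by
  have : CompactSpace (sumZero d ⧸ subLattice k) := (realizationHomeo hk).compactSpace
  have hc : Continuous (Equiv.ofBijective _ (quotientToTorus_bijective (k := k))) :=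
    continuous_quotientToTorus
  exact ⟨(realizationHomeo hk).trans hc.homeoOfEquivCompactToT2⟩

end Complex

theorem mainTheorem5 (d : ℕ) (hd : 1 ≤ d) (k : Fin (d + 1) → ℕ) (hk : ∀ i, 1 ≤ k i) :
    -- no vertex appears more than once in a face
    (∀ F ∈ coxeterFaces d, ∀ x ∈ F ∩ coxeterVertices d, ∀ y ∈ F ∩ coxeterVertices d,
      x - y ∈ subLattice k → x = y) ∧
    -- the classes of faces, ordered by containment, are the faces of a simplicial complex `K` on
    -- the vertices of `T_k`, every class being determined by its set of vertices
    (∃ (K : AbstractSimplicialComplex (TorusVertex k)) (e : TorusFace k ≃o {s // s ∈ K.faces}),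
      (∀ c : TorusFace k, ((e c).1 : Set (TorusVertex k)) = {v | v.1 ≤ c}) ∧
      -- whose realization is the quotient of `V` by the lattice, cut into the images of the faces
      (∃ φ : Realization K ≃ₜ (sumZero d ⧸ subLattice k), ∀ F : coxeterFaces d,
        φ '' {p | p.coord ∈ closedSimplex (e (TorusFace.mk k F)).1} =
          (QuotientAddGroup.mk : sumZero d → sumZero d ⧸ subLattice k) '' F.1) ∧
      -- and is homeomorphic to the `d`-dimensional torus
      Nonempty (Realization K ≃ₜ UnitAddTorus (Fin d))) ∧
    -- the number of vertices
    Finite (TorusVertex k) ∧ (Nat.card (TorusVertex k) : ℤ) = (heawoodMatrix k).det := by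
  refine ⟨?_, ⟨torusComplex k, torusFaceIso hk, coe_faceVertices,
    ⟨realizationHomeo hk, fun F => ?_⟩, nonempty_realization_homeo_torus hk⟩,
    finite_torusVertex, ?_⟩
  · rintro _ ⟨z, rfl⟩ x ⟨hxF, hx⟩ y ⟨hyF, hy⟩ hxy
    lift x to weightLattice d using mem_coxeterVertices.mp hx
    lift y to weightLattice d using mem_coxeterVertices.mp hy
    rw [vertex_mem_closure_coxeterCell] at hxF hyF
    exact congrArg _ (vertexClass_injOn hk z hyF hxF (vertexClass_eq_iff.mpr hxy)).symm
  · obtain ⟨x, rfl⟩ := exists_eq_carrierFace F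
    exact realizationHomeo_image hk x
  · rw [card_torusVertex]
    exact Int.natAbs_of_nonneg det_heawoodMatrix_pos.le
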